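/- All groups and graphs are finite, and graphs are simple. For a positive integer $d$, let $\mathcal{A}(d)$ be the set of pairs $(\Gamma,G)$ where $\Gamma$ is a connected graph of valency at most $d$ and $G\le\mathrm{Aut}(\Gamma)$ is transitive on the vertex set $V\Gamma$. For $f:\mathbb{N}\to\mathbb{N}$, the pair $(\Gamma,G)\in\mathcal{A}(d)$ is called $f$-bounded if $|G_v|\le f(d)$ for every $v\in V\Gamma$. A transitive permutation group is quasiprimitive if all its non-identity normal subgroups are transitive, and biquasiprimitive if it is not quasiprimitive and each of its non-trivial normal subgroups has at most two orbits. The socle $\mathrm{Soc}(G)$ is the subgroup generated by the minimal normal subgroups of $G$. Let $(\Gamma,G)\in\mathcal{A}(d)$ with $G$ biquasiprimitive on $V\Gamma$, and suppose that, for some identification of $V\Gamma$ with $\Delta\times\{1,2\}$, the following hold (permutations act on the right). Let $G^+$ be the subgroup of $G$ that fixes $\Delta\times\{1\}$ and $\Delta\times\{2\}$ setwise, and let $H\le\mathrm{Sym}(\Delta)$ be the permutation group induced by $G^+$ on $\Delta\times\{1\}$. Then: * $H$ is transitive on $\Delta$, and for each $\alpha\in\Delta$ the stabiliser $G_{(\alpha,1)}$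 is intransitive on $\Delta\times\{2\}$; * there are $x\in H$ and $\varphi\in\mathrm{Aut}(H)$ such that $\varphi^2$ is the inner automorphism $y\mapsto x^{-1}yx$, $G^+=\{(y,y^{\varphi}) : y\in H\}$, where $(y_1,y_2)$ denotes the permutation $(\delta,i)\mapsto(\delta^{y_i},i)$, and $G$ contains the element $g=(x,1)(1\,2)$, that is, $(\delta,1)^g=(\delta^x,2)$ and $(\delta,2)^g=(\delta,1)$; * (case (B)) $H$ is not quasiprimitive on $\Delta$, and there is an intransitive minimal normal subgroup $R$ of $H$ such that, with $S=R^{\varphi}$, we have $S\ne R$, the group $M=R\times S$ is a transitive normal subgroup of $H$, and $N=\{(m,m^{\varphi}) : m\in M\}$ is a minimal normal subgroup of $G$; * (case (B)(i)) $\mathrm{Soc}(G)=N$. Suppose moreover that $R$ is non-abelian, and write $R=T_{R,1}\times\cdots\times T_{R,l}$ and $S=T_{S,1}\times\cdots\times T_{S,l}$ with all factors isomorphic to one non-abelian simple group $T$. For $\alpha\in\Delta$ and $1\le j\le l$, let $\pi_{R,j,\alpha}:M_\alpha\to T_{R,j}$ and $\pi_{S,j,\alpha}:M_\alpha\to T_{S,j}$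 be the restrictions to $M_\alpha$ of the natural projections of $M=R\times S$. If $\pi_{R,j,\alpha}$ or $\pi_{S,j,\alpha}$ is surjective for some $j\in\{1,\ldots,l\}$ and some $\alpha\in\Delta$, then $(\Gamma,G)$ is $f$-bounded with $f(d)=\bigl(d^2((d(d-1))!)^2\bigr)!$. -/

import Mathlib

/-! ### Graphs and permutation groups -/

/-- `(Γ, G) ∈ 𝒜(d)`: `d` is a positive integer, `G` is a group of automorphisms of the connected
graph `Γ` that is transitive on the vertices, and the valency of `Γ` is at most `d`. -/
structure MemFamilyA {V : Type*} (d : ℕ) (Γ : SimpleGraph V) (G : Subgroup (Equiv.Perm V)) :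
    Prop where
  pos : 0 < d
  connected : Γ.Connected
  preserves : ∀ g ∈ G, ∀ u v : V, Γ.Adj (g u) (g v) ↔ Γ.Adj u v
  transitive : MulAction.IsPretransitive G V
  valency_le : ∀ v : V, (Γ.neighborSet v).ncard ≤ d

/-- For `(Γ, G) ∈ 𝒜(d)`: every vertex stabiliser has order at most `f d`. -/
def IsFBounded {V : Type*} (f : ℕ → ℕ) (d : ℕ) (G : Subgroup (Equiv.Perm V)) : Prop :=
  ∀ v : V, Nat.card (MulAction.stabilizer G v) ≤ f d

/-- A transitive permutation group that is not quasiprimitive, and all of whose non-trivial normal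
subgroups have at most two orbits. (For a transitive permutation group,
`MulAction.IsQuasiPreprimitive` says that each non-identity normal subgroup is transitive.) -/
structure IsBiquasiprimitive {V : Type*} (G : Subgroup (Equiv.Perm V)) : Prop where
  transitive : MulAction.IsPretransitive G V
  not_quasiprimitive : ¬ MulAction.IsQuasiPreprimitive G V
  orbits_le_two : ∀ N : Subgroup G, N.Normal → N ≠ ⊥ →
    Nat.card (MulAction.orbitRel.Quotient N V) ≤ 2

/-! ### Minimal normal subgroups and the socle -/

structure IsMinimalNormal {A : Type*} [Group A] (N : Subgroup A) : Prop where
  normal : N.Normal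
  ne_bot : N ≠ ⊥
  minimal : ∀ K : Subgroup A, K.Normal → K ≤ N → K = ⊥ ∨ K = N

/-- The socle: the subgroup generated by all minimal normal subgroups. -/
def groupSocle (A : Type*) [Group A] : Subgroup A :=
  sSup {N : Subgroup A | IsMinimalNormal N}

/-! ### Internal direct products and their projections -/

/-- `P` is the internal direct product of the finite family `K` of subgroups. -/
structure IsInternalDirectProduct {A : Type*} [Group A] {ι : Type*} (K : ι → Subgroup A)
    (P : Subgroup A) : Prop where
  commute : Pairwise fun i j => ∀ x y : A, x ∈ K i → y ∈ K j → Commute x y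
  independent : iSupIndep K
  iSup_eq : iSup K = P

namespace IsInternalDirectProduct

variable {A : Type*} [Group A] {ι : Type*} [Fintype ι] {K : ι → Subgroup A} {P : Subgroup A}

theorem range_eq (h : IsInternalDirectProduct K P) :
    (Subgroup.noncommPiCoprod h.commute).range = P := by
  rw [Subgroup.noncommPiCoprod_range, h.iSup_eq]

/-- The multiplication map `∏ i, K i → P` as an isomorphism. -/
noncomputable def mulEquiv (h : IsInternalDirectProduct K P) : (∀ i, K i) ≃* P :=
  (MonoidHom.ofInjective
    (Subgroup.injective_noncommPiCoprod_of_iSupIndep (hcomm := h.commute) h.independent)).trans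
    (MulEquiv.subgroupCongr h.range_eq)

/-- The natural projection of the internal direct product onto its `i`th factor. -/
noncomputable def proj (h : IsInternalDirectProduct K P) (i : ι) : P →* K i :=
  (Pi.evalMonoidHom (fun i => K i) i).comp h.mulEquiv.symm.toMonoidHom

end IsInternalDirectProduct

/-! ### Groups acting on `Δ × {1, 2}`

The set `{1, 2}` is `Fin 2`, its elements being written `0` and `1`. Permutations act on the left
and `g * h` means: first `h`, then `g`. -/

/-- The element `(y 0, y 1)` of the base group: `(δ, i) ↦ (y i δ, i)`. -/
def basePerm {Δ : Type*} (y : Fin 2 → Equiv.Perm Δ) : Equiv.Perm (Δ × Fin 2) where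
  toFun p := (y p.2 p.1, p.2)
  invFun p := ((y p.2)⁻¹ p.1, p.2)
  left_inv p := by simp
  right_inv p := by simp

/-- The permutation `(δ, 1) ↔ (δ, 2)` given by the generator of the top group `Sym(2)`. -/
def topSwap (Δ : Type*) : Equiv.Perm (Δ × Fin 2) :=
  Equiv.prodCongr (Equiv.refl Δ) (Equiv.swap 0 1)

/-- The permutations of `Δ × {1, 2}` that fix `Δ × {1}` and `Δ × {2}` setwise. -/
def sidePreserving (Δ : Type*) : Subgroup (Equiv.Perm (Δ × Fin 2)) where
  carrier := {σ | ∀ p, (σ p).2 = p.2}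
  one_mem' := fun _ => rfl
  mul_mem' := by
    intro a b ha hb p
    exact (ha (b p)).trans (hb p)
  inv_mem' := by
    intro a ha p
    have h := ha (a⁻¹ p)
    simpa using h.symm

/-- The embedding `y ↦ (y, φ y)` of `H` in the base group `H × H`. -/
def diagHom {Δ : Type*} {H : Subgroup (Equiv.Perm Δ)} (φ : MulAut H) :
    H →* Equiv.Perm (Δ × Fin 2) where
  toFun y := basePerm ![(y : Equiv.Perm Δ), ((φ y : H) : Equiv.Perm Δ)]
  map_one' := by
    ext ⟨δ, i⟩ <;> fin_cases i <;> simp [basePerm]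
  map_mul' := by
    intro a b
    ext ⟨δ, i⟩ <;> fin_cases i <;> simp [basePerm]

/-- `Diag_φ(L × L) = {(y, φ y) | y ∈ L}` for a subgroup `L` of `H`. -/
def diagSubgroup {Δ : Type*} {H : Subgroup (Equiv.Perm Δ)} (φ : MulAut H) (L : Subgroup H) :
    Subgroup (Equiv.Perm (Δ × Fin 2)) :=
  L.map (diagHom φ)

/-- The permutation group `G` on `V`, carried to `Δ × {1, 2}` by an identification of `V` with
`Δ × {1, 2}`. -/
def carryGroup {V Δ : Type*} (e : V ≃ Δ × Fin 2) (G : Subgroup (Equiv.Perm V)) :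
    Subgroup (Equiv.Perm (Δ × Fin 2)) :=
  G.map e.permCongrHom.toMonoidHom

/-- The group `S = R ^ φ`. -/
def imageUnder {A : Type*} [Group A] (φ : MulAut A) (R : Subgroup A) : Subgroup A :=
  R.map φ.toMonoidHom

/-- A biquasiprimitive group `G` on `Δ × {1, 2}` in normal form: a point stabiliser in `Δ × {1}` is
intransitive on `Δ × {2}`, the subgroup `G⁺` fixing the two halves is `Diag_φ(H × H)` with `H` the
transitive group that it induces on `Δ × {1}`, some element of `G` outside `G⁺` is
`g = (x, 1)(1 2)` with `x ∈ H`, and `φ²` is conjugation by `x`. With permutations composed from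
right to left, `g` is `topSwap * basePerm ![x, 1]` and conjugation by `x` is `y ↦ x * y * x⁻¹`. -/
structure IsBiquasiprimitiveForm {Δ : Type*} (G : Subgroup (Equiv.Perm (Δ × Fin 2)))
    (H : Subgroup (Equiv.Perm Δ)) (φ : MulAut H) (x : H) : Prop where
  biquasiprimitive : IsBiquasiprimitive G
  stabilizer_intransitive : ∀ α : Δ, ¬ ∀ β β' : Δ, ∃ g ∈ G,
    g (α, 0) = (α, 0) ∧ g (β, 1) = (β', 1)
  transitive : MulAction.IsPretransitive H Δ
  sidePreserving_eq : G ⊓ sidePreserving Δ = diagSubgroup φ ⊤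
  swap_mem : topSwap Δ * basePerm ![(x : Equiv.Perm Δ), 1] ∈ G
  sq_eq : φ * φ = MulAut.conj x

/-- Case (B): `H` is not quasiprimitive; `R` is an intransitive minimal normal subgroup of `H` with
`S = R ^ φ ≠ R`, `M = R × S` is a transitive normal subgroup of `H`, and `N = Diag_φ(M × M)` is a
minimal normal subgroup of `G`. -/
structure IsTypeB {Δ : Type*} (G : Subgroup (Equiv.Perm (Δ × Fin 2)))
    (H : Subgroup (Equiv.Perm Δ)) (φ : MulAut H) (x : H) (R M : Subgroup H) : Prop where
  form : IsBiquasiprimitiveForm G H φ x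
  not_quasiprimitive : ¬ MulAction.IsQuasiPreprimitive H Δ
  minimalNormal : IsMinimalNormal R
  intransitive : ¬ MulAction.IsPretransitive R Δ
  image_ne : imageUnder φ R ≠ R
  product : IsInternalDirectProduct ![R, imageUnder φ R] M
  normal : M.Normal
  product_transitive : MulAction.IsPretransitive M Δ
  diag_le : diagSubgroup φ M ≤ G
  diag_minimalNormal : IsMinimalNormal ((diagSubgroup φ M).subgroupOf G)

/-- Case (B)(i): case (B) with `Soc(G) = N = Diag_φ(M × M)`. -/
structure IsTypeBi {Δ : Type*} (G : Subgroup (Equiv.Perm (Δ × Fin 2)))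
    (H : Subgroup (Equiv.Perm Δ)) (φ : MulAut H) (x : H) (R M : Subgroup H) : Prop
    extends IsTypeB G H φ x R M where
  socle_eq : groupSocle G = (diagSubgroup φ M).subgroupOf G

/-! ### The projections of `M_α` -/

/-- Given `M = R × S` and `R = T₁ × ⋯ × T_l`, the projection `M_α → T_j` on the `j`th coordinate
of `R`. -/
noncomputable def projLeft {Δ : Type*} {H : Subgroup (Equiv.Perm Δ)} {R S M : Subgroup H}
    (hM : IsInternalDirectProduct ![R, S] M) {l : ℕ} {T : Fin l → Subgroup H}
    (hR : IsInternalDirectProduct T R) (j : Fin l) (α : Δ) :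
    MulAction.stabilizer M α →* T j :=
  ((hR.proj j).comp (hM.proj 0)).comp (MulAction.stabilizer M α).subtype

/-- Given `M = R × S` and `S = T₁ × ⋯ × T_l`, the projection `M_α → T_j` on the `j`th coordinate
of `S`. -/
noncomputable def projRight {Δ : Type*} {H : Subgroup (Equiv.Perm Δ)} {R S M : Subgroup H}
    (hM : IsInternalDirectProduct ![R, S] M) {l : ℕ} {T : Fin l → Subgroup H}
    (hS : IsInternalDirectProduct T S) (j : Fin l) (α : Δ) :
    MulAction.stabilizer M α →* T j :=
  ((hS.proj j).comp (hM.proj 1)).comp (MulAction.stabilizer M α).subtype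

/-! The proof bounds the order of `G` itself. The socle N is a power of T with 2l factors. Its
orbits are the two sides of the vertex set, and its factors fall into two halves, those of R and
those of S, which elements of `G` swap exactly when they swap the sides. As N is the socle and has
trivial centre, `G` acts on it faithfully by conjugation. This action permutes the elements
supported on a single factor, so |G| ≤ (2l|T|)!, and it remains to bound |T| and l.

Attach to each side a half of the factors so that, by the hypothesis and transitivity, each N_v
projects onto every factor of the half of its side. The first bound
(`IsHalvedAction.card_map_halfProj_le`) is that the image of N_v in that half has order at most d!,
whence |T| ≤ d!. If the elements of N_v fixing all neighbours of v act trivially in the half, the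
image is a quotient of a permutation group on at most d points. Otherwise they already have the full
image there, because normal subgroups of subdirect powers of T are large
(`exists_mem_forall_apply_eq`). So the image of N_v is contained in that of N_w for a neighbour w on
the other side, and the counting argument applies at w instead.

The second bound (`IsHalvedAction.card_factors_le`) is l ≤ d!^(2d). Each factor gets a code, a
function on the neighbours of v and of w with values in the image of N_v. If two factors shared a
code, the projections of stabilisers to this pair of factors would agree on a whole side
(`IsHalvedAction.map_fix_eq_of_local`), so the projection would be normal in T × T while being the
graph of an automorphism of T, which is impossible. Finally 2 · d!^(2d+1) ≤ d²((d(d-1))!)² for d ≥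
3. -/

/-! ### Surjections onto a non-abelian simple group. -/

section SimpleQuotients

variable {X T : Type*} [Group X] [Group T] [IsSimpleGroup T]

theorem Subgroup.map_eq_top_of_not_le_ker {p : X →* T} (hp : Function.Surjective p)
    {A : Subgroup X} (hA : A.Normal) (h : ¬ A ≤ p.ker) : A.map p = ⊤ := by
  rcases (hA.map p hp).eq_bot_or_eq_top with h0 | h1
  · exact absurd ((Subgroup.map_eq_bot_iff A).1 h0) h
  · exact h1

theorem exists_mem_apply_eq_of_not_le_ker {p : X →* T} (hp : Function.Surjective p)
    {A : Subgroup X} (hA : A.Normal) (h : ¬ A ≤ p.ker) (t : T) : ∃ a ∈ A, p a = t := by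
  have : t ∈ A.map p := by
    rw [Subgroup.map_eq_top_of_not_le_ker hp hA h]; trivial
  exact this

/-- The kernel of a surjection onto a non-abelian simple group is prime among the normal
subgroups. -/
theorem not_inf_le_ker (hT : ∃ a b : T, a * b ≠ b * a) {p : X →* T}
    (hp : Function.Surjective p) {A B : Subgroup X} (hA : A.Normal) (hB : B.Normal)
    (hAp : ¬ A ≤ p.ker) (hBp : ¬ B ≤ p.ker) : ¬ A ⊓ B ≤ p.ker := by
  obtain ⟨s, t, hst⟩ := hT
  obtain ⟨a, ha, rfl⟩ := exists_mem_apply_eq_of_not_le_ker hp hA hAp s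
  obtain ⟨b, hb, rfl⟩ := exists_mem_apply_eq_of_not_le_ker hp hB hBp t
  intro hle
  -- The commutator lies in both normal subgroups, but its image is a non-trivial commutator in `T`.
  have hmem : a * b * a⁻¹ * b⁻¹ ∈ A ⊓ B := by
    refine ⟨?_, B.mul_mem (hB.conj_mem b hb a) (B.inv_mem hb)⟩
    have := A.mul_mem ha (hA.conj_mem _ (A.inv_mem ha) b)
    simpa [mul_assoc] using this
  have := hle hmem
  rw [MonoidHom.mem_ker] at this
  simp only [map_mul, map_inv] at this
  apply hst
  rw [mul_inv_eq_one, mul_inv_eq_iff_eq_mul] at this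
  exact this

theorem not_biInf_le_ker (hT : ∃ a b : T, a * b ≠ b * a) {p : X →* T}
    (hp : Function.Surjective p) {κ : Type*} (s : Finset κ) (A : κ → Subgroup X)
    (hA : ∀ k, (A k).Normal) (h : ∀ k ∈ s, ¬ A k ≤ p.ker) : ¬ (⨅ k ∈ s, A k) ≤ p.ker := by
  classical
  induction s using Finset.induction_on with
  | empty =>
    simp only [Finset.notMem_empty, iInf_false, iInf_top]
    intro hle
    obtain ⟨a, b, hab⟩ := hT
    obtain ⟨a, rfl⟩ := hp a
    have : p a = 1 := hle (Subgroup.mem_top a)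
    exact hab (by simp [this])
  | insert k s hk ih =>
    rw [Finset.iInf_insert]
    refine not_inf_le_ker hT hp (hA k) ?_ (h k (by simp)) (ih fun j hj => h j (by simp [hj]))
    exact Subgroup.normal_iInf_normal fun j => Subgroup.normal_iInf_normal fun _ => hA j

/-- The kernel of a surjection onto a simple group is maximal among the proper normal subgroups. -/
theorem ker_eq_ker_of_le {p q : X →* T} (hp : Function.Surjective p)
    (hq : Function.Surjective q) (h : p.ker ≤ q.ker) : p.ker = q.ker := by
  refine le_antisymm h ?_
  by_contra hn
  obtain ⟨t, ht⟩ := exists_ne (1 : T)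
  obtain ⟨x, rfl⟩ := hq t
  obtain ⟨y, hy, hxy⟩ := exists_mem_apply_eq_of_not_le_ker hp q.normal_ker hn (p x)
  have : x * y⁻¹ ∈ p.ker := by simp [MonoidHom.mem_ker, hxy]
  have := h this
  rw [MonoidHom.mem_ker] at this hy
  simp [hy] at this
  exact ht this

/-- A normal subgroup that is non-trivial under each of finitely many surjections onto a
non-abelian simple group has the same image as the whole group under their product. -/
theorem exists_mem_forall_apply_eq (hT : ∃ a b : T, a * b ≠ b * a) {κ : Type*} [Finite κ]
    (p : κ → X →* T) (hp : ∀ k, Function.Surjective (p k)) {L : Subgroup X} (hL : L.Normal)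
    (h : ∀ k, ¬ L ≤ (p k).ker) (x : X) : ∃ y ∈ L, ∀ k, p k y = p k x := by
  classical
  have key : ∀ s : Finset κ, ∃ y ∈ L, ∀ k ∈ s, p k y = p k x := by
    intro s
    induction s using Finset.induction_on with
    | empty => exact ⟨1, L.one_mem, by simp⟩
    | insert j s hj ih =>
      obtain ⟨y, hy, hys⟩ := ih
      -- Either coordinate `j` is determined by those in `s`, so agreement is automatic, or
      -- primality of the kernel lets `L` correct coordinate `j` by an element invisible to `s`.
      by_cases hQ : (⨅ k ∈ s, (p k).ker) ≤ (p j).ker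
      · refine ⟨y, hy, fun k hk => ?_⟩
        rcases Finset.mem_insert.1 hk with rfl | hk
        · have : y⁻¹ * x ∈ (p k).ker := hQ (by
            simp only [Subgroup.mem_iInf, MonoidHom.mem_ker, map_mul, map_inv]
            intro i hi
            rw [hys i hi, inv_mul_cancel])
          rw [MonoidHom.mem_ker, map_mul, map_inv, inv_mul_eq_one] at this
          exact this
        · exact hys k hk
      · have hn : (⨅ k ∈ s, (p k).ker).Normal :=
          Subgroup.normal_iInf_normal fun k => Subgroup.normal_iInf_normal fun _ =>
            (p k).normal_ker
        obtain ⟨c, ⟨hcL, hcQ⟩, hc⟩ := exists_mem_apply_eq_of_not_le_ker (hp j)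
          (Subgroup.normal_inf_normal L _) (not_inf_le_ker hT (hp j) hL hn (h j) hQ)
          (p j (y⁻¹ * x))
        refine ⟨y * c, L.mul_mem hy hcL, fun k hk => ?_⟩
        rcases Finset.mem_insert.1 hk with rfl | hk
        · simp [hc]
        · have : p k c = 1 := by
            have hcQ' : c ∈ ⨅ k ∈ s, (p k).ker := hcQ
            simp only [Subgroup.mem_iInf] at hcQ'
            exact hcQ' k hk
          simp [this, hys k hk]
  cases nonempty_fintype κ
  obtain ⟨y, hy, h⟩ := key Finset.univ
  exact ⟨y, hy, fun k => h k (Finset.mem_univ k)⟩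

/-- Distinct kernels of surjections onto a non-abelian simple group are told apart by elements. -/
theorem exists_ker_mark (hT : ∃ a b : T, a * b ≠ b * a) {κ : Type*} [Finite κ]
    (p : κ → X →* T) (hp : ∀ k, Function.Surjective (p k)) :
    ∃ z : κ → X, ∀ i j, z i = z j → (p i).ker = (p j).ker := by
  classical
  cases nonempty_fintype κ
  -- By primality, the intersection of all kernels other than that of `p i` is not contained in it.
  have key : ∀ i, ∃ z, p i z ≠ 1 ∧ ∀ j, (p j).ker ≠ (p i).ker → p j z = 1 := by
    intro i
    have := not_biInf_le_ker hT (hp i)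
      (Finset.univ.filter fun j => (p j).ker ≠ (p i).ker) (fun j => (p j).ker)
      (fun j => (p j).normal_ker) (fun j hj hle => by
        simp only [Finset.mem_filter, Finset.mem_univ, true_and] at hj
        exact hj (ker_eq_ker_of_le (hp j) (hp i) hle))
    obtain ⟨z, hz, hzi⟩ := SetLike.not_le_iff_exists.1 this
    refine ⟨z, hzi, fun j hj => ?_⟩
    simp only [Subgroup.mem_iInf, Finset.mem_filter, Finset.mem_univ, true_and] at hz
    exact hz j hj
  choose z hz1 hz2 using key
  refine ⟨z, fun i j hij => ?_⟩
  by_contra hne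
  exact hz1 i (hij ▸ hz2 j i hne)

end SimpleQuotients

/-! ### Automorphisms of a power of a simple group. -/

section Power

variable {T ι : Type*} [Group T] [IsSimpleGroup T] [Finite ι] [DecidableEq ι]

/-- An automorphism of a power of a non-abelian simple group permutes the factors. -/
theorem MulEquiv.exists_source (hT : ∃ a b : T, a * b ≠ b * a)
    (Φ : (ι → T) ≃* (ι → T)) (j : ι) : ∃ (i : ι) (θ : T ≃* T), ∀ x, Φ x j = θ (x i) := by
  cases nonempty_fintype ι
  set q : (ι → T) →* T := (Pi.evalMonoidHom (fun _ => T) j).comp Φ.toMonoidHom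
  have hqa : ∀ x, q x = Φ x j := fun x => rfl
  have hev : ∀ i, Function.Surjective (Pi.evalMonoidHom (fun _ : ι => T) i) :=
    fun i => Function.surjective_eval i
  have hq : Function.Surjective q := (hev j).comp Φ.surjective
  -- The coordinate kernels intersect trivially, so by primality one of them lies in the kernel of
  -- `q`.
  obtain ⟨i, hi⟩ : ∃ i, (Pi.evalMonoidHom (fun _ : ι => T) i).ker ≤ q.ker := by
    by_contra hno
    push Not at hno
    apply not_biInf_le_ker hT hq Finset.univ
      (fun i => (Pi.evalMonoidHom (fun _ : ι => T) i).ker) (fun i => MonoidHom.normal_ker _)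
      fun i _ => hno i
    intro x hx
    simp only [Subgroup.mem_iInf, Finset.mem_univ, forall_const, MonoidHom.mem_ker] at hx
    have : x = 1 := funext hx
    simp [this]
  have hker := ker_eq_ker_of_le (hev i) hq hi
  have hqi : ∀ x, q x = q (Pi.mulSingle i (x i)) := by
    intro x
    have : x * (Pi.mulSingle i (x i))⁻¹ ∈ q.ker := hi (by
      simp [MonoidHom.mem_ker])
    rw [MonoidHom.mem_ker, map_mul, map_inv, mul_inv_eq_one] at this
    exact this
  refine ⟨i, MulEquiv.ofBijective (q.comp (MonoidHom.mulSingle (fun _ => T) i)) ⟨?_, ?_⟩, ?_⟩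
  · rw [injective_iff_map_eq_one]
    intro t ht
    have : Pi.mulSingle i t ∈ (Pi.evalMonoidHom (fun _ : ι => T) i).ker := by
      rw [hker]; exact ht
    simpa [MonoidHom.mem_ker] using this
  · intro t
    obtain ⟨x, rfl⟩ := hq t
    exact ⟨x i, (hqi x).symm⟩
  · intro x
    exact hqi x

theorem MulEquiv.exists_target (hT : ∃ a b : T, a * b ≠ b * a)
    (Φ : (ι → T) ≃* (ι → T)) (i : ι) : ∃ (j : ι) (θ : T ≃* T), ∀ x, Φ x j = θ (x i) := by
  obtain ⟨j, θ, h⟩ := MulEquiv.exists_source hT Φ.symm i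
  refine ⟨j, θ.symm, fun x => ?_⟩
  rw [MulEquiv.eq_symm_apply, ← h, MulEquiv.symm_apply_apply]

/-- The number of automorphisms of a power `T ^ n` of a non-abelian simple group is at most
`(n * |T|)!`. -/
theorem card_le_factorial_of_injective_mulAut (hT : ∃ a b : T, a * b ≠ b * a) [Finite T]
    {A : Type*} [Group A] (c : A →* MulAut (ι → T)) (hc : Function.Injective c) :
    Nat.card A ≤ (Nat.card ι * Nat.card T).factorial := by
  -- The elements supported on one coordinate generate the power, and automorphisms permute them.
  let D : Set (ι → T) := Set.range fun q : ι × T => Pi.mulSingle q.1 q.2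
  have hD : ∀ (Φ : MulAut (ι → T)) x, x ∈ D → Φ x ∈ D := by
    rintro Φ _ ⟨⟨i, t⟩, rfl⟩
    obtain ⟨j, θ, h⟩ := MulEquiv.exists_target hT Φ i
    refine ⟨⟨j, θ t⟩, ?_⟩
    dsimp only
    have hs := h (Pi.mulSingle i t)
    funext k
    by_cases hk : k = j
    · subst hk; simp [hs]
    · rw [Pi.mulSingle_eq_of_ne hk]
      obtain ⟨i', θ', h'⟩ := MulEquiv.exists_source hT Φ k
      rw [h']
      have hi' : i' ≠ i := by
        rintro rfl
        obtain ⟨s, hs1⟩ := exists_ne (1 : T)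
        obtain ⟨x, hx⟩ := Φ.surjective (Pi.mulSingle k s)
        have h1 := h x
        have h2 := h' x
        rw [hx, Pi.mulSingle_eq_same] at h2
        rw [hx, Pi.mulSingle_eq_of_ne (Ne.symm hk)] at h1
        have h3 : x i' = 1 := by simpa using h1.symm
        rw [h3, map_one] at h2
        exact hs1 h2
      rw [Pi.mulSingle_eq_of_ne hi', map_one]
  let f : A → Equiv.Perm D := fun a =>
    { toFun := fun x => ⟨c a x, hD _ _ x.2⟩
      invFun := fun x => ⟨(c a)⁻¹ x, hD _ _ x.2⟩
      left_inv := fun x => by ext1; simp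
      right_inv := fun x => by ext1; simp }
  have hf : Function.Injective f := by
    intro a b hab
    apply hc
    have : ∀ i t, c a (Pi.mulSingle i t) = c b (Pi.mulSingle i t) := fun i t =>
      congrArg Subtype.val (Equiv.congr_fun hab ⟨_, ⟨(i, t), rfl⟩⟩)
    have h2 : (c a).toMonoidHom = (c b).toMonoidHom := by
      refine MonoidHom.pi_ext fun i t => ?_
      exact this i t
    ext x : 1
    exact DFunLike.congr_fun h2 x
  calc Nat.card A ≤ Nat.card (Equiv.Perm D) := Nat.card_le_card_of_injective f hf
    _ = (Nat.card D).factorial := Nat.card_perm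
    _ ≤ (Nat.card ι * Nat.card T).factorial := by
      apply Nat.factorial_le
      rw [← Nat.card_prod]
      exact Finite.card_range_le _

end Power

/-! ### Vertex stabilisers in the normal subgroup and their projections to one half. -/

theorem SimpleGraph.Connected.apply_eq_of_adj {V β : Type*} {Γ : SimpleGraph V}
    (hΓ : Γ.Connected) (F : V → β) (hF : ∀ u v, Γ.Adj u v → F u = F v) (u v : V) :
    F u = F v := by
  obtain ⟨p⟩ := hΓ.preconnected u v
  induction p with
  | nil => rfl
  | cons h _ ih => exact (hF _ _ h).trans ih

theorem perm_fin_two_eq_one : ∀ (s : Equiv.Perm (Fin 2)) (t : Fin 2), s t = t → s = 1 := by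
  decide

theorem perm_fin_two_apply_apply :
    ∀ (s : Equiv.Perm (Fin 2)) (t : Fin 2), s t ≠ t → s (s t) = t := by
  decide

/-- A vertex-transitive action of `A` on a connected graph of valency at most `d`, with a normal
subgroup `T ^ (2 l)` whose two orbits on vertices are the fibres of `side`, the `2 l` factors being
split into two halves such that an element of `A` swaps the halves of the factors if and only if it
swaps the two orbits. Here `c` is the conjugation action of `A` on the normal subgroup. -/
structure IsHalvedAction {V A T : Type*} [Group A] [MulAction A V] [Group T] {l : ℕ} (d : ℕ)
    (Γ : SimpleGraph V) (ψ : (Fin 2 × Fin l → T) →* A) (c : A →* MulAut (Fin 2 × Fin l → T))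
    (side : V → Fin 2) : Prop where
  noncomm : ∃ a b : T, a * b ≠ b * a
  connected : Γ.Connected
  adj_smul : ∀ (a : A) u v, Γ.Adj u v → Γ.Adj (a • u) (a • v)
  valency_le : ∀ v, (Γ.neighborSet v).ncard ≤ d
  transitive : ∀ u v : V, ∃ a : A, a • u = v
  injective : Function.Injective ψ
  conj_injective : Function.Injective c
  map_conj : ∀ a x, ψ (c a x) = a * ψ x * a⁻¹
  side_surjective : Function.Surjective side
  side_smul : ∀ x v, side (ψ x • v) = side v
  exists_smul_eq : ∀ u v, side u = side v → ∃ x, ψ x • u = v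
  swap : ∀ a : A, ∃ s : Equiv.Perm (Fin 2), (∀ v, side (a • v) = s (side v)) ∧
    ∀ t x, (∀ j, x (t, j) = 1) → ∀ j, c a x (s t, j) = 1
  irreducible : ∀ X : Subgroup (Fin 2 × Fin l → T), (∀ a, ∀ x ∈ X, c a x ∈ X) → X = ⊥ ∨ X = ⊤

namespace IsHalvedAction

variable {V A T : Type*} [Group A] [MulAction A V] [Group T] {l : ℕ} {d : ℕ}
    {Γ : SimpleGraph V} {ψ : (Fin 2 × Fin l → T) →* A} {c : A →* MulAut (Fin 2 × Fin l → T)}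
    {side : V → Fin 2}

/-- The elements of `T ^ (2 l)` fixing `v`. -/
def fix (ψ : (Fin 2 × Fin l → T) →* A) (v : V) : Subgroup (Fin 2 × Fin l → T) :=
  (MulAction.stabilizer A v).comap ψ

theorem mem_fix {v : V} {x : Fin 2 × Fin l → T} : x ∈ fix ψ v ↔ ψ x • v = v := Iff.rfl

/-- The elements of `T ^ (2 l)` fixing `v` and all its neighbours. -/
def fixBall (Γ : SimpleGraph V) (ψ : (Fin 2 × Fin l → T) →* A) (v : V) :
    Subgroup (Fin 2 × Fin l → T) :=
  fix ψ v ⊓ ⨅ u ∈ Γ.neighborSet v, fix ψ u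

theorem mem_fixBall {v : V} {x : Fin 2 × Fin l → T} :
    x ∈ fixBall Γ ψ v ↔ x ∈ fix ψ v ∧ ∀ u, Γ.Adj v u → x ∈ fix ψ u := by
  simp [fixBall, Subgroup.mem_inf, Subgroup.mem_iInf]

/-- The projection of `T ^ (2 l)` onto one half of its factors. -/
def halfProj (T : Type*) [Group T] (l : ℕ) (t : Fin 2) : (Fin 2 × Fin l → T) →* (Fin l → T) where
  toFun x j := x (t, j)
  map_one' := rfl
  map_mul' _ _ := rfl

@[simp] theorem halfProj_apply (t : Fin 2) (x : Fin 2 × Fin l → T) (j : Fin l) :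
    halfProj T l t x j = x (t, j) := rfl

/-- Conjugation by `a` carries the factor `i` to the factor `j`. -/
def Carries (c : A →* MulAut (Fin 2 × Fin l → T)) (a : A) (i j : Fin 2 × Fin l) : Prop :=
  ∃ θ : T ≃* T, ∀ x, c a x j = θ (x i)

theorem carries_one (i : Fin 2 × Fin l) : Carries c 1 i i := ⟨MulEquiv.refl T, by simp⟩

theorem Carries.mul {a b : A} {i j k : Fin 2 × Fin l} (hb : Carries c b j k)
    (ha : Carries c a i j) : Carries c (b * a) i k := by
  obtain ⟨θ, h⟩ := ha
  obtain ⟨θ', h'⟩ := hb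
  exact ⟨θ.trans θ', fun x => by simp [h, h']⟩

theorem Carries.inv {a : A} {i j : Fin 2 × Fin l} (ha : Carries c a i j) :
    Carries c a⁻¹ j i := by
  obtain ⟨θ, h⟩ := ha
  refine ⟨θ.symm, fun x => ?_⟩
  rw [MulEquiv.eq_symm_apply, ← h]
  simp

theorem side_eq_of_carries [IsSimpleGroup T] {a : A} {s : Equiv.Perm (Fin 2)}
    (hs : ∀ t x, (∀ j, x (t, j) = 1) → ∀ j, c a x (s t, j) = 1) {i j : Fin 2 × Fin l}
    (hij : Carries c a i j) : s i.1 = j.1 := by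
  by_contra hne
  obtain ⟨θ, hθ⟩ := hij
  obtain ⟨τ, hτ⟩ := exists_ne (1 : T)
  have h1 := hs (s.symm j.1) (Pi.mulSingle i τ) (fun k => by
    rw [Pi.mulSingle_eq_of_ne]
    rintro rfl
    exact hne (by simp)) j.2
  rw [Equiv.apply_symm_apply] at h1
  have h2 := hθ (Pi.mulSingle i τ)
  rw [Pi.mulSingle_eq_same] at h2
  rw [show j = (j.1, j.2) from rfl, h1] at h2
  exact hτ (by simpa using h2.symm)

section

variable (h : IsHalvedAction d Γ ψ c side)
include h

theorem conj_mem_fix (a : A) {x : Fin 2 × Fin l → T} {v : V} (hx : x ∈ fix ψ v) :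
    c a x ∈ fix ψ (a • v) := by
  rw [mem_fix] at hx ⊢
  rw [h.map_conj, smul_smul, inv_mul_cancel_right, mul_smul, hx]

theorem adj_smul_iff (a : A) {u v : V} : Γ.Adj (a • u) (a • v) ↔ Γ.Adj u v := by
  refine ⟨fun hh => ?_, h.adj_smul a u v⟩
  simpa using h.adj_smul a⁻¹ _ _ hh

theorem conj_mem_fixBall (a : A) {x : Fin 2 × Fin l → T} {v : V} (hx : x ∈ fixBall Γ ψ v) :
    c a x ∈ fixBall Γ ψ (a • v) := by
  rw [mem_fixBall] at hx ⊢
  refine ⟨h.conj_mem_fix a hx.1, fun u hu => ?_⟩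
  have := h.conj_mem_fix a (hx.2 (a⁻¹ • u) (by
    rw [← h.adj_smul_iff a]; simpa using hu))
  simpa using this

theorem conj_apply (y x : Fin 2 × Fin l → T) : c (ψ y) x = y * x * y⁻¹ := by
  apply h.injective
  simp [h.map_conj]

/-- Irreducibility forces the factors to form one orbit: the elements trivial on an orbit of factors
form an invariant subgroup. -/
theorem exists_carries [IsSimpleGroup T] (i j : Fin 2 × Fin l) : ∃ a, Carries c a i j := by
  by_contra hno
  obtain ⟨τ, hτ⟩ := exists_ne (1 : T)
  let X : Subgroup (Fin 2 × Fin l → T) :=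
    { carrier := {x | ∀ k, (∃ a, Carries c a i k) → x k = 1}
      one_mem' := fun _ _ => rfl
      mul_mem' := fun {x y} hx hy k hk => by simp [hx k hk, hy k hk]
      inv_mem' := fun {x} hx k hk => by simp [hx k hk] }
  rcases h.irreducible X (by
    rintro a x hx k ⟨b, hb⟩
    obtain ⟨k0, θ, hθ⟩ := MulEquiv.exists_source h.noncomm (c a) k
    have hk0 : Carries c a k0 k := ⟨θ, hθ⟩
    rw [hθ, hx k0 ⟨_, hk0.inv.mul hb⟩, map_one]) with hX | hX
  · have : Pi.mulSingle j τ ∈ X := by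
      intro k hk
      have hkj : k ≠ j := by
        rintro rfl
        exact hno hk
      rw [Pi.mulSingle_eq_of_ne hkj]
    rw [hX, Subgroup.mem_bot, Pi.mulSingle_eq_one_iff] at this
    exact hτ this
  · have : Pi.mulSingle i τ ∈ X := hX ▸ Subgroup.mem_top _
    have := this i ⟨1, carries_one i⟩
    exact hτ (by simpa using this)

/-- An element carrying `i` to `j` in the same half preserves the sides. Since the normal subgroup
is transitive on each side and moves no factor, it can be used to bring `v` back. -/
theorem exists_stabilizer_carries [IsSimpleGroup T] (v : V) {i j : Fin 2 × Fin l}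
    (hij : i.1 = j.1) : ∃ a : A, a • v = v ∧ Carries c a i j := by
  obtain ⟨a, ha⟩ := h.exists_carries i j
  obtain ⟨s, hs1, hs2⟩ := h.swap a
  have hst := side_eq_of_carries hs2 ha
  have hs : s = 1 := perm_fin_two_eq_one s i.1 (hst.trans hij.symm)
  obtain ⟨y, hy⟩ := h.exists_smul_eq (a • v) v (by rw [hs1, hs]; rfl)
  refine ⟨ψ y * a, by rw [mul_smul, hy], Carries.mul ⟨MulAut.conj (y j), fun x => ?_⟩ ha⟩
  rw [h.conj_apply]
  rfl

/-- If some vertex stabiliser projects onto a factor in the half that corresponds to the side of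
the vertex, then all do. -/
theorem surjective_of_surjective [IsSimpleGroup T] {v₀ : V} {i₀ : Fin 2 × Fin l}
    (hi₀ : i₀.1 = side v₀) (hsurj : ∀ t, ∃ x ∈ fix ψ v₀, x i₀ = t) (v : V) (i : Fin 2 × Fin l)
    (hi : i.1 = side v) (t : T) : ∃ x ∈ fix ψ v, x i = t := by
  obtain ⟨a, rfl⟩ := h.transitive v₀ v
  obtain ⟨s, hs1, hs2⟩ := h.swap a
  obtain ⟨j, θ, hθ⟩ := MulEquiv.exists_target h.noncomm (c a) i₀
  have hj : j.1 = i.1 := by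
    rw [← side_eq_of_carries hs2 ⟨θ, hθ⟩, hi, hs1, hi₀]
  obtain ⟨b, hb, θ', hθ'⟩ := h.exists_stabilizer_carries (a • v₀) hj
  obtain ⟨x, hx, hxt⟩ := hsurj (θ.symm (θ'.symm t))
  refine ⟨c b (c a x), ?_, by simp [hθ, hθ', hxt]⟩
  have := h.conj_mem_fix b (h.conj_mem_fix a hx)
  rwa [hb] at this

/-- The stabiliser of `v` normalises the ball fixer and is transitive on the factors in each half.
-/
theorem exists_ne_one_fixBall [IsSimpleGroup T] {v : V} {t : Fin 2}
    (hn : ¬ fixBall Γ ψ v ≤ (halfProj T l t).ker) (j : Fin l) :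
    ∃ x ∈ fixBall Γ ψ v, x (t, j) ≠ 1 := by
  obtain ⟨x, hx, hxn⟩ := SetLike.not_le_iff_exists.1 hn
  obtain ⟨k, hk⟩ : ∃ k, x (t, k) ≠ 1 := by
    by_contra hno
    push Not at hno
    exact hxn (funext hno)
  obtain ⟨a, ha, θ, hθ⟩ := h.exists_stabilizer_carries v (i := (t, k)) (j := (t, j)) rfl
  refine ⟨c a x, ?_, by rw [hθ]; simpa using hk⟩
  have := h.conj_mem_fixBall a hx
  rwa [ha] at this

theorem exists_mem_fixBall [IsSimpleGroup T] {κ : Type*} [Finite κ] (f : κ → Fin 2 × Fin l)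
    {v : V} (hs : ∀ k t, ∃ x ∈ fix ψ v, x (f k) = t)
    (hn : ∀ k, ∃ x ∈ fixBall Γ ψ v, x (f k) ≠ 1)
    {x : Fin 2 × Fin l → T} (hx : x ∈ fix ψ v) :
    ∃ y ∈ fixBall Γ ψ v, ∀ k, y (f k) = x (f k) := by
  have hnorm : ((fixBall Γ ψ v).subgroupOf (fix ψ v)).Normal := by
    refine ⟨fun n hn g => ?_⟩
    rw [Subgroup.mem_subgroupOf] at hn ⊢
    have h1 := h.conj_mem_fixBall (ψ g) hn
    rw [h.conj_apply, mem_fix.1 g.2] at h1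
    exact h1
  obtain ⟨y, hy, hyk⟩ := exists_mem_forall_apply_eq h.noncomm
    (fun k => (Pi.evalMonoidHom (fun _ => T) (f k)).comp (fix ψ v).subtype)
    (fun k t => by
      obtain ⟨x, hx, hxt⟩ := hs k t
      exact ⟨⟨x, hx⟩, hxt⟩) hnorm (fun k hle => by
      obtain ⟨x, hx, hxn⟩ := hn k
      exact hxn (hle (x := ⟨x, (mem_fixBall.1 hx).1⟩) hx)) ⟨x, hx⟩
  exact ⟨y, hy, hyk⟩

/-- The image is a quotient of the permutation group that `fix ψ v` induces on the neighbours of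
`v`. -/
theorem card_map_le_factorial [Finite V] {B : Type*} [Group B] (f : (Fin 2 × Fin l → T) →* B)
    {v : V} (hf : fixBall Γ ψ v ≤ f.ker) : Nat.card ((fix ψ v).map f) ≤ d.factorial := by
  have key : ∀ y : (fix ψ v).map f, ∃ x ∈ fix ψ v, f x = y := fun y => y.2
  choose x hx hxy using key
  have hadj : ∀ y u, Γ.Adj v u → Γ.Adj v (ψ (x y) • u) := fun y u hu => by
    have := h.adj_smul (ψ (x y)) v u hu
    rwa [mem_fix.1 (hx y)] at this
  have hadj' : ∀ y u, Γ.Adj v u → Γ.Adj v ((ψ (x y))⁻¹ • u) := fun y u hu => by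
    have := h.adj_smul (ψ (x y))⁻¹ v u hu
    rwa [inv_smul_eq_iff.2 (mem_fix.1 (hx y)).symm] at this
  let σ : (fix ψ v).map f → Equiv.Perm (Γ.neighborSet v) := fun y =>
    { toFun := fun u => ⟨ψ (x y) • u.1, hadj y u u.2⟩
      invFun := fun u => ⟨(ψ (x y))⁻¹ • u.1, hadj' y u u.2⟩
      left_inv := fun u => by ext1; simp
      right_inv := fun u => by ext1; simp }
  have hσ : Function.Injective σ := by
    intro y z hyz
    ext1
    rw [← hxy y, ← hxy z, eq_comm, ← inv_mul_eq_one, ← map_inv, ← map_mul]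
    apply hf
    rw [mem_fixBall]
    refine ⟨mul_mem (inv_mem (hx z)) (hx y), fun u hu => ?_⟩
    have := congrArg Subtype.val (Equiv.congr_fun hyz ⟨u, hu⟩)
    change ψ (x y) • u = ψ (x z) • u at this
    rw [mem_fix, map_mul, map_inv, mul_smul, this, inv_smul_smul]
  calc Nat.card ((fix ψ v).map f) ≤ Nat.card (Equiv.Perm (Γ.neighborSet v)) :=
        Nat.card_le_card_of_injective σ hσ
    _ = (Nat.card (Γ.neighborSet v)).factorial := Nat.card_perm
    _ ≤ d.factorial := by
      apply Nat.factorial_le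
      rw [Nat.card_coe_set_eq]
      exact h.valency_le v

/-- Edges inside the sides are allowed, but by vertex-transitivity a vertex without a neighbour
across would make `side` constant on the connected graph. -/
theorem exists_adj_side_ne (v : V) : ∃ w, Γ.Adj v w ∧ side w ≠ side v := by
  by_contra hno
  push Not at hno
  have : ∀ u w, Γ.Adj u w → side u = side w := by
    intro u w huw
    obtain ⟨a, rfl⟩ := h.transitive v u
    obtain ⟨s, hs, -⟩ := h.swap a
    have h1 := hno (a⁻¹ • w) (by rw [← h.adj_smul_iff a]; simpa using huw)
    have h2 := hs (a⁻¹ • w)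
    rw [smul_inv_smul, h1] at h2
    rw [h2, hs]
  obtain ⟨u, hu⟩ := h.side_surjective 0
  obtain ⟨w, hw⟩ := h.side_surjective 1
  have := h.connected.apply_eq_of_adj side this u w
  rw [hu, hw] at this
  exact absurd this (by decide)

/-- Otherwise adjacent vertices have the same stabiliser in the normal subgroup, so by connectedness
it fixes every vertex and is trivial by faithfulness. -/
theorem not_fix_le_fixBall [FaithfulSMul A V] {v : V} {i : Fin 2 × Fin l} [IsSimpleGroup T]
    (hs : ∀ t, ∃ x ∈ fix ψ v, x i = t) : ¬ fix ψ v ≤ fixBall Γ ψ v := by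
  intro hle
  have hedge : ∀ u w, Γ.Adj u w → fix ψ u ≤ fix ψ w := by
    intro u w huw x hx
    obtain ⟨a, rfl⟩ := h.transitive v u
    have h1 := h.conj_mem_fix a⁻¹ hx
    rw [inv_smul_smul] at h1
    have h2 := (mem_fixBall.1 (hle h1)).2 (a⁻¹ • w)
      (by rw [← h.adj_smul_iff a]; simpa using huw)
    have h3 := h.conj_mem_fix a h2
    simpa using h3
  have hall := h.connected.apply_eq_of_adj (fix ψ) fun u w huw =>
    le_antisymm (hedge u w huw) (hedge w u huw.symm)
  obtain ⟨τ, hτ⟩ := exists_ne (1 : T)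
  obtain ⟨x, hx, rfl⟩ := hs τ
  apply hτ
  have : ψ x = 1 := by
    apply FaithfulSMul.eq_of_smul_eq_smul (α := V)
    intro u
    rw [one_smul]
    rw [hall v u] at hx
    exact hx
  rw [h.injective (this.trans (map_one ψ).symm)]
  rfl

/-- The projection of a vertex stabiliser onto the half of the factors corresponding to its side
has order at most `d!`. -/
theorem card_map_halfProj_le [FaithfulSMul A V] [IsSimpleGroup T] [Finite V] [Finite T]
    (hs : ∀ v (i : Fin 2 × Fin l), i.1 = side v → ∀ t, ∃ x ∈ fix ψ v, x i = t) (v : V) :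
    Nat.card ((fix ψ v).map (halfProj T l (side v))) ≤ d.factorial := by
  by_cases h1 : fixBall Γ ψ v ≤ (halfProj T l (side v)).ker
  · exact h.card_map_le_factorial _ h1
  obtain ⟨w, hvw, hw⟩ := h.exists_adj_side_ne v
  obtain ⟨a, rfl⟩ := h.transitive v w
  obtain ⟨s, hs1, hs2⟩ := h.swap a
  have hn1 := h.exists_ne_one_fixBall h1
  -- The ball fixer has the same image in this half as `fix ψ v`, and it also fixes the neighbour `a
  -- • v`.
  have hle : (fix ψ v).map (halfProj T l (side v)) ≤
      (fix ψ (a • v)).map (halfProj T l (side v)) := by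
    rintro _ ⟨x, hx, rfl⟩
    obtain ⟨y, hy, hyx⟩ := h.exists_mem_fixBall (fun j => (side v, j))
      (fun j => hs v _ rfl) hn1 hx
    exact ⟨y, (mem_fixBall.1 hy).2 _ hvw, funext hyx⟩
  have hss : s (side (a • v)) = side v := by
    have := hs1 v
    rw [this] at hw ⊢
    exact perm_fin_two_apply_apply s _ hw
  have hst : ∀ t, t = side v ∨ t = side (a • v) := by
    revert hw
    generalize side v = t
    generalize side (a • v) = t'
    revert t t'
    decide
  -- Otherwise `fix ψ v` projects onto all 2l factors and the ball fixer is non-trivial on each, so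
  -- the two coincide, contrary to `not_fix_le_fixBall`.
  have h2 : fixBall Γ ψ v ≤ (halfProj T l (side (a • v))).ker := by
    by_contra h2
    have hn2 := h.exists_ne_one_fixBall h2
    have hl : Nonempty (Fin l) := by
      by_contra hl
      rw [not_nonempty_iff] at hl
      exact h2 fun x _ => Subsingleton.elim _ _
    obtain ⟨j₀⟩ := hl
    have hsv : ∀ (i : Fin 2 × Fin l) t, ∃ x ∈ fix ψ v, x i = t := by
      have hone : ∀ t, ∃ x ∈ fix ψ (a • v), x (side v, j₀) = t := fun t => by
        obtain ⟨_, ⟨x, hx, rfl⟩, hxt⟩ : ∃ y ∈ (fix ψ v).map (halfProj T l (side v)),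
            y j₀ = t := by
          obtain ⟨x, hx, hxt⟩ := hs v (side v, j₀) rfl t
          exact ⟨_, ⟨x, hx, rfl⟩, hxt⟩
        obtain ⟨y, hy, hyx⟩ := hle ⟨x, hx, rfl⟩
        exact ⟨y, hy, (congrFun hyx j₀).trans hxt⟩
      rintro ⟨t, j⟩ τ
      rcases hst t with rfl | rfl
      · exact hs v _ rfl τ
      -- By `hle`, the stabiliser of `a • v` also projects onto a factor in the half of `v`.
      -- Conjugating by `a⁻¹` makes `fix ψ v` project onto some factor in the other half.
      · obtain ⟨k, θ, hθ⟩ := MulEquiv.exists_source h.noncomm (c a) (side v, j₀)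
        have hk : k.1 = side (a • v) := by
          have := side_eq_of_carries hs2 ⟨θ, hθ⟩
          rw [← hss] at this
          exact s.injective this
        obtain ⟨b, hb, θ', hθ'⟩ := h.exists_stabilizer_carries v
          (i := k) (j := (side (a • v), j)) hk
        obtain ⟨x, hx, hxt⟩ := hone (θ (θ'.symm τ))
        have hx1 := h.conj_mem_fix b (h.conj_mem_fix a⁻¹ hx)
        rw [inv_smul_smul, hb] at hx1
        refine ⟨_, hx1, ?_⟩
        have h3 := hθ (c a⁻¹ x)
        rw [map_inv, MulAut.apply_inv_self, hxt, EmbeddingLike.apply_eq_iff_eq] at h3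
        rw [hθ', map_inv, ← h3, MulEquiv.apply_symm_apply]
    refine h.not_fix_le_fixBall (hsv (side v, j₀)) fun x hx => ?_
    obtain ⟨y, hy, hyx⟩ := h.exists_mem_fixBall (κ := Fin 2 × Fin l) id hsv (by
      rintro ⟨t, j⟩
      rcases hst t with rfl | rfl
      · exact hn1 j
      · exact hn2 j) hx
    rwa [← show y = x from funext hyx]
  -- This is `h2` conjugated by `a`, which swaps the two halves.
  have h3 : fixBall Γ ψ (a • v) ≤ (halfProj T l (side v)).ker := by
    intro x hx
    have hx1 := h.conj_mem_fixBall a⁻¹ hx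
    rw [inv_smul_smul] at hx1
    have hx2 : ∀ j, c a⁻¹ x (side (a • v), j) = 1 := fun j => congrFun (h2 hx1) j
    have hx3 := hs2 _ _ hx2
    rw [hss, map_inv, MulAut.apply_inv_self] at hx3
    exact funext hx3
  exact (Subgroup.card_le_of_le hle).trans (h.card_map_le_factorial _ h3)

end

end IsHalvedAction

/-! ### Bounding the number of factors. -/

namespace IsHalvedAction

variable {V A T : Type*} [Group A] [MulAction A V] [Group T] {l : ℕ} {d : ℕ}
    {Γ : SimpleGraph V} {ψ : (Fin 2 × Fin l → T) →* A} {c : A →* MulAut (Fin 2 × Fin l → T)}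
    {side : V → Fin 2}

/-- The projection of `T ^ (2 l)` onto two factors of the half `t`. -/
def pairProj (T : Type*) [Group T] {l : ℕ} (t : Fin 2) (j j' : Fin l) :
    (Fin 2 × Fin l → T) →* T × T :=
  (Pi.evalMonoidHom (fun _ => T) (t, j)).prod (Pi.evalMonoidHom (fun _ => T) (t, j'))

@[simp] theorem pairProj_apply (t : Fin 2) (j j' : Fin l) (x : Fin 2 × Fin l → T) :
    pairProj T t j j' x = (x (t, j), x (t, j')) := rfl

section

variable (h : IsHalvedAction d Γ ψ c side)
include h

theorem map_fix_smul {B : Type*} [Group B] (f : (Fin 2 × Fin l → T) →* B) (n : Fin 2 × Fin l → T)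
    (u : V) :
    (fix ψ (ψ n • u)).map f = ((fix ψ u).map f).map (MulAut.conj (f n)).toMonoidHom := by
  apply le_antisymm
  · rintro _ ⟨x, hx, rfl⟩
    have h1 := h.conj_mem_fix (ψ n)⁻¹ hx
    rw [inv_smul_smul, ← map_inv, h.conj_apply] at h1
    exact ⟨_, ⟨_, h1, rfl⟩, by simp [mul_assoc]⟩
  · rintro _ ⟨_, ⟨x, hx, rfl⟩, rfl⟩
    have h1 := h.conj_mem_fix (ψ n) hx
    rw [h.conj_apply] at h1
    exact ⟨_, h1, by simp⟩

/-- If the projections of vertex stabilisers agree on enough vertices near `v` and `w`, then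
they agree on all vertices on the side of `v`. -/
theorem map_fix_eq_of_local {B : Type*} [Group B] (f : (Fin 2 × Fin l → T) →* B) {v w : V}
    (hw : side w ≠ side v)
    (hv1 : ∀ u, Γ.Adj v u → side u = side v → (fix ψ u).map f = (fix ψ v).map f)
    (hw1 : ∀ u, Γ.Adj w u → side u = side v → (fix ψ u).map f = (fix ψ v).map f)
    (hw2 : ∀ w', Γ.Adj w w' → side w' ≠ side v →
      ∃ u, Γ.Adj w' u ∧ side u = side v ∧ (fix ψ u).map f = (fix ψ v).map f)
    (u : V) (hu : side u = side v) : (fix ψ u).map f = (fix ψ v).map f := by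
  classical
  -- Translating by the normal subgroup conjugates the projections, so each local hypothesis spreads
  -- along a whole side.
  have hshift : ∀ (n : Fin 2 × Fin l → T) (x y : V), (fix ψ x).map f = (fix ψ y).map f →
      (fix ψ (ψ n • x)).map f = (fix ψ (ψ n • y)).map f := fun n x y hxy => by
    rw [h.map_fix_smul, h.map_fix_smul, hxy]
  have hb0 : ∀ u u', side u = side v → side u' = side v → Γ.Adj u u' →
      (fix ψ u).map f = (fix ψ u').map f := by
    intro u u' hu hu' huu
    obtain ⟨n, rfl⟩ := h.exists_smul_eq v u hu.symm
    have h1 := hv1 ((ψ n)⁻¹ • u') (by rw [← h.adj_smul_iff (ψ n)]; simpa using huu)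
      (by rw [← map_inv, h.side_smul, hu'])
    have h2 := hshift n _ _ h1
    rw [smul_inv_smul] at h2
    exact h2.symm
  have hfin : ∀ x y z : Fin 2, x ≠ z → y ≠ z → x = y := by decide
  have hb1' : ∀ w' u', side w' ≠ side v → side u' = side v → Γ.Adj w' u' →
      ∀ n, ψ n • w = w' → (fix ψ u').map f = (fix ψ (ψ n • v)).map f := by
    rintro w' u' hw' hu' hwu n rfl
    have h1 := hw1 ((ψ n)⁻¹ • u') (by rw [← h.adj_smul_iff (ψ n)]; simpa using hwu)
      (by rw [← map_inv, h.side_smul, hu'])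
    have h2 := hshift n _ _ h1
    rwa [smul_inv_smul] at h2
  have hb1 : ∀ w' u u', side w' ≠ side v → side u = side v → side u' = side v →
      Γ.Adj w' u → Γ.Adj w' u' → (fix ψ u).map f = (fix ψ u').map f := by
    intro w' u u' hw' hu hu' hwu hwu'
    obtain ⟨n, hn⟩ := h.exists_smul_eq w w' (hfin _ _ _ hw hw')
    rw [hb1' w' u hw' hu hwu n hn, hb1' w' u' hw' hu' hwu' n hn]
  choose cr hcr1 hcr2 using h.exists_adj_side_ne
  have hcr3 : ∀ x, side x ≠ side v → side (cr x) = side v := fun x hx =>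
    hfin _ _ (side x) (hcr2 x) (Ne.symm hx)
  -- A vertex across from `v` is represented by a chosen neighbour on the side of `v`. This extends
  -- the projection to a function on all vertices that can be shown constant along edges.
  let F : V → Subgroup B := fun x =>
    if side x = side v then (fix ψ x).map f else (fix ψ (cr x)).map f
  have hF : ∀ x y, Γ.Adj x y → F x = F y := by
    intro x y hxy
    by_cases hx : side x = side v <;> by_cases hy : side y = side v <;>
      simp only [F, hx, hy, if_true, if_false]
    · exact hb0 x y hx hy hxy
    · exact hb1 y x (cr y) hy hx (hcr3 y hy) hxy.symm (hcr1 y)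
    · exact hb1 x (cr x) y hx (hcr3 x hx) hy (hcr1 x) hxy
    · obtain ⟨n, hn⟩ := h.exists_smul_eq w x (hfin _ _ _ hw hx)
      have hwy : Γ.Adj w ((ψ n)⁻¹ • y) := by
        rw [← h.adj_smul_iff (ψ n), hn]; simpa using hxy
      obtain ⟨u, hu1, hu2, hu3⟩ := hw2 ((ψ n)⁻¹ • y) hwy
        (by rw [← map_inv, h.side_smul]; exact hy)
      have h2 := hshift n _ _ hu3
      rw [hb1' x (cr x) hx (hcr3 x hx) (hcr1 x) n hn, ← h2]
      refine hb1 y _ _ hy ?_ (hcr3 y hy) ?_ (hcr1 y)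
      · rw [h.side_smul, hu2]
      · have := h.adj_smul (ψ n) _ _ hu1
        rwa [smul_inv_smul] at this
  have := h.connected.apply_eq_of_adj F hF u v
  simpa [F, hu] using this

/-- Counts injective codes of factors by at most `2 * d` elements of a group `K` of order at most
`d.factorial`. -/
theorem card_factors_le [FaithfulSMul A V] [IsSimpleGroup T] [Finite V] [Finite T]
    (hs : ∀ v (i : Fin 2 × Fin l), i.1 = side v → ∀ t, ∃ x ∈ fix ψ v, x i = t) :
    l ≤ d.factorial ^ (2 * d) := by
  classical
  obtain ⟨v, -⟩ := h.side_surjective 0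
  obtain ⟨w, hvw, hw⟩ := h.exists_adj_side_ne v
  choose cr hcr1 hcr2 using h.exists_adj_side_ne
  have hcr3 : ∀ x, side x ≠ side v → side (cr x) = side v := fun x hx => by
    have hfin : ∀ x y z : Fin 2, x ≠ z → y ≠ z → x = y := by decide
    exact hfin _ _ (side x) (hcr2 x) (Ne.symm hx)
  let K := (fix ψ v).map (halfProj T l (side v))
  have hp : ∀ j : Fin l, Function.Surjective
      ((Pi.evalMonoidHom (fun _ => T) j).comp K.subtype) := by
    intro j τ
    obtain ⟨x, hx, hxt⟩ := hs v (side v, j) rfl τ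
    exact ⟨⟨_, ⟨x, hx, rfl⟩⟩, hxt⟩
  obtain ⟨mark, hmark⟩ := exists_ker_mark h.noncomm _ hp
  have hn : ∀ u : {u // side u = side v}, ∃ n, ψ n • v = u := fun u =>
    h.exists_smul_eq v u u.2.symm
  choose n hn using hn
  -- `z u j` records the `j`th coordinate of the translation `n u` by an element of the small group
  -- `K`.
  choose z hz using fun (u : {u // side u = side v}) (j : Fin l) => hp j (n u (side v, j))
  let ρ : Γ.neighborSet v ⊕ Γ.neighborSet w → {u // side u = side v} := Sum.elim
    (fun u => if hu : side u.1 = side v then ⟨u, hu⟩ else ⟨v, rfl⟩)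
    (fun u => if hu : side u.1 = side v then ⟨u, hu⟩ else ⟨cr u, hcr3 _ hu⟩)
  -- At the position of `w` among the neighbours of `v`, the value of `ρ` is only the default `v`,
  -- so this slot is free to store the mark identifying the kernel of coordinate `j` on `K`.
  let F : Fin l → (Γ.neighborSet v ⊕ Γ.neighborSet w → K) := fun j i =>
    if i = Sum.inl ⟨w, hvw⟩ then mark j else z (ρ i) j
  have hF : Function.Injective F := by
    intro j j' hjj
    by_contra hne
    have hker := hmark j j' (by simpa [F] using congrFun hjj (Sum.inl ⟨w, hvw⟩))
    have hρ : ∀ i, (fix ψ (ρ i).1).map (pairProj T (side v) j j') =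
        (fix ψ v).map (pairProj T (side v) j j') := by
      intro i
      by_cases hi : i = Sum.inl ⟨w, hvw⟩
      · have : (ρ i).1 = v := by simp [ρ, hi, hw]
        rw [this]
      · have hzz : z (ρ i) j = z (ρ i) j' := by simpa [F, hi] using congrFun hjj i
        -- On these two factors the translation agrees with an element fixing `v`, so it does not
        -- change the projection of `fix ψ v`.
        obtain ⟨x, hx, hxz⟩ : ∃ x ∈ fix ψ v, halfProj T l (side v) x = z (ρ i) j :=
          (z (ρ i) j).2
        have h1 : x (side v, j) = n (ρ i) (side v, j) := by
          rw [← hz (ρ i) j]; exact congrFun hxz j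
        have h2 : x (side v, j') = n (ρ i) (side v, j') := by
          rw [← hz (ρ i) j', ← hzz]; exact congrFun hxz j'
        have h3 : pairProj T (side v) j j' (n (ρ i)) = pairProj T (side v) j j' x := by
          simp [h1, h2]
        rw [← hn (ρ i), h.map_fix_smul, h3, ← h.map_fix_smul, mem_fix.1 hx]
    have hall := h.map_fix_eq_of_local (pairProj T (side v) j j') hw
      (fun u hu hus => by simpa [ρ, hus] using hρ (Sum.inl ⟨u, hu⟩))
      (fun u hu hus => by simpa [ρ, hus] using hρ (Sum.inr ⟨u, hu⟩))
      (fun u hu hus => ⟨cr u, hcr1 u, hcr3 u hus, by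
        simpa [ρ, hus] using hρ (Sum.inr ⟨u, hu⟩)⟩)
    -- By `hall` the pair projection is normalised by (a, 1), which turns the first coordinate b
    -- into aba⁻¹ and keeps the second. Equal kernels mean that the second coordinate determines the
    -- first, so a and b would commute.
    obtain ⟨a, b, hab⟩ := h.noncomm
    obtain ⟨x, hx, hxb⟩ := hs v (side v, j) rfl b
    let m : Fin 2 × Fin l → T := Pi.mulSingle (side v, j) a
    have hm := hall (ψ m • v) (h.side_smul m v)
    rw [h.map_fix_smul] at hm
    have hmem : MulAut.conj (pairProj T (side v) j j' m) (pairProj T (side v) j j' x) ∈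
        (fix ψ v).map (pairProj T (side v) j j') := by
      rw [← hm]
      exact ⟨_, ⟨x, hx, rfl⟩, rfl⟩
    obtain ⟨y, hy, hyx⟩ := hmem
    have hm1 : m (side v, j) = a := Pi.mulSingle_eq_same _ _
    have hm2 : m (side v, j') = 1 := Pi.mulSingle_eq_of_ne (by
      simpa using Ne.symm hne) _
    simp only [pairProj_apply, MulAut.conj_apply, hm1, hm2, hxb, Prod.mk_mul_mk, Prod.inv_mk,
      Prod.mk.injEq, one_mul, inv_one, mul_one] at hyx
    let k : K := ⟨halfProj T l (side v) (y * x⁻¹), _, mul_mem hy (inv_mem hx), rfl⟩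
    have hk : k ∈ ((Pi.evalMonoidHom (fun _ => T) j').comp K.subtype).ker := by
      change (y * x⁻¹) (side v, j') = 1
      simp [hyx.2]
    rw [← hker] at hk
    have hk' : (y * x⁻¹) (side v, j) = 1 := hk
    simp only [Pi.mul_apply, Pi.inv_apply, hyx.1, hxb] at hk'
    rw [mul_inv_eq_one, mul_inv_eq_iff_eq_mul] at hk'
    exact hab hk'
  calc l = Nat.card (Fin l) := by simp
    _ ≤ Nat.card (Γ.neighborSet v ⊕ Γ.neighborSet w → K) := Nat.card_le_card_of_injective F hF
    _ = Nat.card K ^ (Nat.card (Γ.neighborSet v) + Nat.card (Γ.neighborSet w)) := by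
      rw [Nat.card_fun, Nat.card_sum]
    _ ≤ d.factorial ^ (Nat.card (Γ.neighborSet v) + Nat.card (Γ.neighborSet w)) :=
      Nat.pow_le_pow_left (h.card_map_halfProj_le hs v) _
    _ ≤ d.factorial ^ (2 * d) := by
      apply Nat.pow_le_pow_right (Nat.factorial_pos d)
      have h1 := h.valency_le v
      have h2 := h.valency_le w
      rw [Nat.card_coe_set_eq, Nat.card_coe_set_eq]
      omega

end

end IsHalvedAction

/-! ### The numerical estimate. -/

section Arithmetic

theorem Nat.factorial_succ_le_pow (k : ℕ) : (k + 1).factorial ≤ (k + 1) ^ k := by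
  induction k with
  | zero => simp
  | succ k ih =>
    rw [Nat.factorial_succ, pow_succ']
    exact Nat.mul_le_mul_left _ (ih.trans (Nat.pow_le_pow_left (by omega) _))

theorem Nat.factorial_pow_mul_le (d : ℕ) (hd : 0 < d) (n : ℕ) :
    d.factorial ^ n * n.factorial * d ^ n ≤ (d * n).factorial * d := by
  induction n with
  | zero => simpa [Nat.one_le_iff_ne_zero] using hd.ne'
  | succ n ih =>
    -- The comparison of growth factors below needs d ≤ dn + 1, so n = 0 is separate; there equality
    -- holds.
    rcases Nat.eq_zero_or_pos n with rfl | hn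
    · simp
    obtain ⟨k, rfl⟩ : ∃ k, d = k + 1 := ⟨d - 1, by omega⟩
    have h1 := Nat.factorial_mul_pow_le_factorial (m := (k + 1) * n) (n := k)
    have h2 : (k + 1).factorial ≤ ((k + 1) * n + 1) ^ k :=
      (Nat.factorial_succ_le_pow k).trans (Nat.pow_le_pow_left (by nlinarith) _)
    have h3 : ((k + 1) * (n + 1)).factorial =
        (k + 1) * (n + 1) * ((k + 1) * n + k).factorial := by
      rw [show (k + 1) * (n + 1) = ((k + 1) * n + k) + 1 by ring, Nat.factorial_succ]
    calc (k + 1).factorial ^ (n + 1) * (n + 1).factorial * (k + 1) ^ (n + 1)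
        = ((k + 1).factorial ^ n * n.factorial * (k + 1) ^ n) *
          ((k + 1).factorial * ((k + 1) * (n + 1))) := by
          rw [Nat.factorial_succ n]; ring
      _ ≤ (((k + 1) * n).factorial * (k + 1)) *
          (((k + 1) * n + 1) ^ k * ((k + 1) * (n + 1))) := by gcongr
      _ = (((k + 1) * n).factorial * ((k + 1) * n + 1) ^ k) *
          ((k + 1) * (n + 1)) * (k + 1) := by ring
      _ ≤ ((k + 1) * n + k).factorial * ((k + 1) * (n + 1)) * (k + 1) := by gcongr
      _ = ((k + 1) * (n + 1)).factorial * (k + 1) := by rw [h3]; ring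

theorem Nat.two_mul_factorial_pow_le {d : ℕ} (hd : 3 ≤ d) :
    2 * d.factorial ^ (2 * d + 1) ≤ d ^ 2 * (d * (d - 1)).factorial ^ 2 := by
  -- The general argument uses 2 · d! ≤ d^(2d-4), which fails at d = 3.
  rcases Nat.eq_or_lt_of_le hd with rfl | hd
  · simp [Nat.factorial]
  obtain ⟨k, rfl⟩ : ∃ k, d = k + 4 := ⟨d - 4, by omega⟩
  have h1 := Nat.factorial_pow_mul_le (k + 4) (by omega) (k + 3)
  have h2 : (k + 4).factorial ≤ (k + 4) ^ (k + 3) := Nat.factorial_succ_le_pow (k + 3)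
  have h3 : 2 ≤ (k + 4) ^ (k + 1) :=
    calc 2 ≤ (k + 4) ^ 1 := by rw [pow_one]; omega
      _ ≤ _ := Nat.pow_le_pow_right (by omega) (by omega)
  have h4 : (k + 4).factorial ^ (k + 3) * (k + 3).factorial * (k + 4) ^ (k + 3) =
      (k + 4).factorial ^ (k + 4) * (k + 4) ^ (k + 2) := by
    rw [pow_succ (k + 4).factorial (k + 3)]
    have h5 : (k + 4).factorial = (k + 4) * (k + 3).factorial := Nat.factorial_succ (k + 3)
    rw [mul_assoc, mul_assoc, pow_succ (k + 4) (k + 2)]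
    congr 1
    rw [h5]
    ring
  rw [h4] at h1
  have h5 : 2 * (k + 4).factorial ≤ ((k + 4) ^ (k + 2)) ^ 2 :=
    calc 2 * (k + 4).factorial ≤ (k + 4) ^ (k + 1) * (k + 4) ^ (k + 3) := Nat.mul_le_mul h3 h2
      _ = ((k + 4) ^ (k + 2)) ^ 2 := by ring
  have h6 : k + 4 - 1 = k + 3 := rfl
  rw [h6]
  calc 2 * (k + 4).factorial ^ (2 * (k + 4) + 1)
      = ((k + 4).factorial ^ (k + 4)) ^ 2 * (2 * (k + 4).factorial) := by
        rw [pow_succ, mul_comm 2 (k + 4), pow_mul]; ring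
    _ ≤ ((k + 4).factorial ^ (k + 4)) ^ 2 * ((k + 4) ^ (k + 2)) ^ 2 :=
        Nat.mul_le_mul_left _ h5
    _ = ((k + 4).factorial ^ (k + 4) * (k + 4) ^ (k + 2)) ^ 2 := by rw [mul_pow]
    _ ≤ (((k + 4) * (k + 3)).factorial * (k + 4)) ^ 2 := Nat.pow_le_pow_left h1 2
    _ = _ := by ring

end Arithmetic

/-! ### The bound for the whole group. -/

theorem three_le_card_of_noncomm {T : Type*} [Group T] [Finite T]
    (hT : ∃ a b : T, a * b ≠ b * a) : 3 ≤ Nat.card T := by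
  obtain ⟨a, b, hab⟩ := hT
  have hf : Function.Injective ![1, a, b] := by
    intro i j hij
    fin_cases i <;> fin_cases j <;> simp at hij ⊢ <;> subst hij <;> simp_all
  simpa using Nat.card_le_card_of_injective _ hf

theorem IsHalvedAction.card_le {V A T : Type*} [Group A] [MulAction A V] [FaithfulSMul A V]
    [Group T] [IsSimpleGroup T] [Finite V] [Finite T] {l d : ℕ} {Γ : SimpleGraph V}
    {ψ : (Fin 2 × Fin l → T) →* A} {c : A →* MulAut (Fin 2 × Fin l → T)} {side : V → Fin 2}
    (h : IsHalvedAction d Γ ψ c side) {v₀ : V} {i₀ : Fin 2 × Fin l} (hi₀ : i₀.1 = side v₀)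
    (hsurj : ∀ t, ∃ x, ψ x • v₀ = v₀ ∧ x i₀ = t) :
    Nat.card A ≤ (d ^ 2 * (d * (d - 1)).factorial ^ 2).factorial := by
  have hs : ∀ v (i : Fin 2 × Fin l), i.1 = side v → ∀ t, ∃ x ∈ fix ψ v, x i = t :=
    h.surjective_of_surjective hi₀ hsurj
  have hT : Nat.card T ≤ d.factorial := by
    refine le_trans ?_ (h.card_map_halfProj_le hs v₀)
    refine Nat.card_le_card_of_surjective (fun y => y.1 i₀.2) fun t => ?_
    obtain ⟨x, hx, hxt⟩ := hs v₀ (side v₀, i₀.2) rfl t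
    exact ⟨⟨_, ⟨x, hx, rfl⟩⟩, hxt⟩
  have hd : 3 ≤ d := by
    have h3 := (three_le_card_of_noncomm h.noncomm).trans hT
    by_contra hd
    have : d.factorial ≤ Nat.factorial 2 := Nat.factorial_le (by omega)
    simp at this
    omega
  refine (card_le_factorial_of_injective_mulAut h.noncomm c h.conj_injective).trans
    (Nat.factorial_le ?_)
  calc Nat.card (Fin 2 × Fin l) * Nat.card T = 2 * (l * Nat.card T) := by
        simp [mul_assoc]
    _ ≤ 2 * (d.factorial ^ (2 * d) * d.factorial) := by
        gcongr
        exact h.card_factors_le hs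
    _ = 2 * d.factorial ^ (2 * d + 1) := by rw [pow_succ]
    _ ≤ _ := Nat.two_mul_factorial_pow_le hd

/-! ### Coordinates on internal direct products. -/

namespace IsInternalDirectProduct

variable {A : Type*} [Group A] {ι : Type*} [Fintype ι] {K : ι → Subgroup A} {P : Subgroup A}

theorem mulEquiv_coe (h : IsInternalDirectProduct K P) (f : ∀ i, K i) :
    (h.mulEquiv f : A) = Subgroup.noncommPiCoprod h.commute f := rfl

theorem mulEquiv_proj (h : IsInternalDirectProduct K P) (m : P) :
    h.mulEquiv (fun i => h.proj i m) = m :=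
  h.mulEquiv.apply_symm_apply m

theorem proj_mulEquiv (h : IsInternalDirectProduct K P) (f : ∀ i, K i) (i : ι) :
    h.proj i (h.mulEquiv f) = f i :=
  congrFun (h.mulEquiv.symm_apply_apply f) i

theorem eq_one_of_proj_eq_one (h : IsInternalDirectProduct K P) {m : P}
    (hm : ∀ i, h.proj i m = 1) : m = 1 := by
  rw [← h.mulEquiv_proj m, show (fun i => h.proj i m) = 1 from funext hm, map_one]

theorem mem_iff_forall_proj_eq_one (h : IsInternalDirectProduct K P) (i : ι) (m : P) :
    (m : A) ∈ K i ↔ ∀ j, j ≠ i → h.proj j m = 1 := by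
  classical
  constructor
  · intro hm j hj
    have : m = h.mulEquiv (Pi.mulSingle i ⟨m, hm⟩) := by
      ext1
      rw [mulEquiv_coe, Subgroup.noncommPiCoprod_mulSingle]
    rw [this, proj_mulEquiv, Pi.mulSingle_eq_of_ne hj]
  · intro hm
    have h1 : (fun j => h.proj j m) = Pi.mulSingle i (h.proj i m) := by
      funext j
      by_cases hj : j = i
      · subst hj; simp
      · rw [Pi.mulSingle_eq_of_ne hj, hm j hj]
    have h2 := h.mulEquiv_proj m
    rw [h1] at h2
    rw [← h2, mulEquiv_coe, Subgroup.noncommPiCoprod_mulSingle]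
    exact (h.proj i m).2

/-- A product of two powers of a group `T` as one power. -/
theorem exists_mulEquiv_pi {T : Type*} [Group T] {l : ℕ} {R S M : Subgroup A}
    {TR TS : Fin l → Subgroup A} (hM : IsInternalDirectProduct ![R, S] M)
    (hR : IsInternalDirectProduct TR R) (hS : IsInternalDirectProduct TS S)
    (τR : ∀ j, TR j ≃* T) (τS : ∀ j, TS j ≃* T) :
    ∃ Ψ : M ≃* (Fin 2 × Fin l → T),
      (∀ m j, Ψ m (0, j) = τR j (hR.proj j (hM.proj 0 m))) ∧
      ∀ m j, Ψ m (1, j) = τS j (hS.proj j (hM.proj 1 m)) := by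
  let π : Fin 2 → Fin l → M →* T :=
    ![fun j => (τR j).toMonoidHom.comp ((hR.proj j).comp (hM.proj 0)),
      fun j => (τS j).toMonoidHom.comp ((hS.proj j).comp (hM.proj 1))]
  have hπ0 : ∀ j m, π 0 j m = τR j (hR.proj j (hM.proj 0 m)) := fun _ _ => rfl
  have hπ1 : ∀ j m, π 1 j m = τS j (hS.proj j (hM.proj 1 m)) := fun _ _ => rfl
  let F : M →* (Fin 2 × Fin l → T) := MonoidHom.pi fun i => π i.1 i.2
  have hF : ∀ m i, F m i = π i.1 i.2 m := fun _ _ => rfl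
  refine ⟨MulEquiv.ofBijective F ⟨?_, ?_⟩, fun m j => rfl, fun m j => rfl⟩
  · rw [injective_iff_map_eq_one]
    intro m hm
    refine hM.eq_one_of_proj_eq_one ?_
    rw [Fin.forall_fin_two]
    constructor
    · refine hR.eq_one_of_proj_eq_one fun j => ?_
      have : F m (0, j) = 1 := by rw [hm]; rfl
      rw [hF, hπ0] at this
      simpa using this
    · refine hS.eq_one_of_proj_eq_one fun j => ?_
      have : F m (1, j) = 1 := by rw [hm]; rfl
      rw [hF, hπ1] at this
      simpa using this
  · intro x
    let yR : R := hR.mulEquiv fun j => (τR j).symm (x (0, j))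
    let yS : S := hS.mulEquiv fun j => (τS j).symm (x (1, j))
    let f : ∀ i, (![R, S] : Fin 2 → Subgroup A) i := fun i => match i with
      | 0 => yR
      | 1 => yS
    refine ⟨hM.mulEquiv f, ?_⟩
    have h0 : hM.proj 0 (hM.mulEquiv f) = yR := hM.proj_mulEquiv f 0
    have h1 : hM.proj 1 (hM.mulEquiv f) = yS := hM.proj_mulEquiv f 1
    funext ⟨t, j⟩
    rw [hF]
    revert t
    rw [Fin.forall_fin_two]
    constructor
    · change π 0 j _ = _
      rw [hπ0, h0, hR.proj_mulEquiv, MulEquiv.apply_symm_apply]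
    · change π 1 j _ = _
      rw [hπ1, h1, hS.proj_mulEquiv, MulEquiv.apply_symm_apply]

end IsInternalDirectProduct

/-! ### Faithful conjugation on the socle. -/

theorem exists_isMinimalNormal_le {A : Type*} [Group A] [Finite A] {C : Subgroup A}
    (hC : C.Normal) (hne : C ≠ ⊥) : ∃ L, IsMinimalNormal L ∧ L ≤ C := by
  obtain ⟨L, hLC, hL⟩ := Set.Finite.exists_le_minimal
    (s := {K : Subgroup A | K.Normal ∧ K ≠ ⊥}) (Set.toFinite _) ⟨hC, hne⟩
  refine ⟨L, ⟨hL.prop.1, hL.prop.2, fun K hK hKL => ?_⟩, hLC⟩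
  by_cases hb : K = ⊥
  · exact Or.inl hb
  · exact Or.inr (le_antisymm hKL (hL.le_of_le ⟨hK, hb⟩ hKL))

/-- The conjugation action of `A` on a normal subgroup that is the image of `ψ`. -/
theorem exists_conj_hom {E A : Type*} [Group E] [Group A] {ψ : E →* A}
    (hψ : Function.Injective ψ) (hn : ψ.range.Normal) :
    ∃ c : A →* MulAut E, ∀ a x, ψ (c a x) = a * ψ x * a⁻¹ := by
  let ψe : E ≃* ψ.range := MonoidHom.ofInjective hψ
  refine ⟨(MulAut.congr ψe.symm).toMonoidHom.comp (MulAut.conjNormal (H := ψ.range)),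
    fun a x => ?_⟩
  have h1 : ∀ y, ψ (ψe.symm y) = y := fun y =>
    congrArg Subtype.val (ψe.apply_symm_apply y)
  change ψ (ψe.symm (MulAut.conjNormal a (ψe x))) = _
  rw [h1, MulAut.conjNormal_apply]
  rfl

theorem eq_one_of_forall_commute {T ι : Type*} [Group T] [IsSimpleGroup T]
    (hT : ∃ a b : T, a * b ≠ b * a) {x : ι → T} (hx : ∀ y, x * y = y * x) : x = 1 := by
  classical
  funext i
  have hi : x i ∈ Subgroup.center T := by
    rw [Subgroup.mem_center_iff]
    intro t
    simpa using (congrFun (hx (fun _ => t)) i).symm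
  have hnorm : (Subgroup.center T).Normal := inferInstance
  rcases hnorm.eq_bot_or_eq_top with h0 | h1
  · rw [h0] at hi
    exact hi
  · obtain ⟨a, b, hab⟩ := hT
    have : b ∈ Subgroup.center T := h1 ▸ Subgroup.mem_top b
    exact absurd (Subgroup.mem_center_iff.1 this a) hab

/-- A group acts faithfully by conjugation on its socle, if that is a power of a non-abelian
simple group. -/
theorem conj_hom_injective_of_socle_eq {A T ι : Type*} [Group A] [Finite A] [Group T]
    [IsSimpleGroup T] (hT : ∃ a b : T, a * b ≠ b * a) {ψ : (ι → T) →* A}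
    (hψ : Function.Injective ψ) (hsoc : groupSocle A = ψ.range) {c : A →* MulAut (ι → T)}
    (hc : ∀ a x, ψ (c a x) = a * ψ x * a⁻¹) : Function.Injective c := by
  rw [← MonoidHom.ker_eq_bot_iff]
  by_contra hne
  -- A minimal normal subgroup inside the kernel lies in the socle and centralises it, but the socle
  -- has trivial centre.
  obtain ⟨L, hL, hLc⟩ := exists_isMinimalNormal_le c.normal_ker hne
  apply hL.ne_bot
  rw [eq_bot_iff]
  intro a ha
  have has : a ∈ ψ.range := hsoc ▸ (le_sSup (a := L) hL : L ≤ groupSocle A) ha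
  obtain ⟨x, rfl⟩ := has
  have hx : x = 1 := eq_one_of_forall_commute hT fun y => by
    have h1 := hc (ψ x) y
    rw [MonoidHom.mem_ker.1 (hLc ha), MulAut.one_apply, eq_mul_inv_iff_mul_eq] at h1
    apply hψ
    rw [map_mul, map_mul, h1]
  rw [hx, map_one]
  exact Subgroup.mem_bot.2 rfl

/-- Which half belongs to which side is only a labelling, because the permutations of two points
commute. This treats surjectivity onto a factor of S like that onto a factor of R. -/
theorem IsHalvedAction.comp_perm {V A T : Type*} [Group A] [MulAction A V] [Group T] {l d : ℕ}
    {Γ : SimpleGraph V} {ψ : (Fin 2 × Fin l → T) →* A} {c : A →* MulAut (Fin 2 × Fin l → T)}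
    {side : V → Fin 2} (h : IsHalvedAction d Γ ψ c side) (τ : Equiv.Perm (Fin 2)) :
    IsHalvedAction d Γ ψ c (τ ∘ side) where
  noncomm := h.noncomm
  connected := h.connected
  adj_smul := h.adj_smul
  valency_le := h.valency_le
  transitive := h.transitive
  injective := h.injective
  conj_injective := h.conj_injective
  map_conj := h.map_conj
  side_surjective := τ.surjective.comp h.side_surjective
  side_smul x v := congrArg τ (h.side_smul x v)
  exists_smul_eq u v huv := h.exists_smul_eq u v (τ.injective huv)
  swap a := by
    obtain ⟨s, hs1, hs2⟩ := h.swap a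
    refine ⟨s, fun v => ?_, hs2⟩
    have hcomm : ∀ (s τ : Equiv.Perm (Fin 2)) t, τ (s t) = s (τ t) := by decide
    simp [hs1, hcomm]
  irreducible := h.irreducible

/-! ### The biquasiprimitive group and its diagonal socle. -/

section Diagonal

variable {Δ : Type*} {H : Subgroup (Equiv.Perm Δ)} {φ : MulAut H}

@[simp] theorem diagHom_apply_zero (y : H) (δ : Δ) : diagHom φ y (δ, 0) = (y.1 δ, 0) := rfl

@[simp] theorem diagHom_apply_one (y : H) (δ : Δ) : diagHom φ y (δ, 1) = ((φ y).1 δ, 1) := rfl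

theorem diagHom_apply_snd (y : H) (p : Δ × Fin 2) : (diagHom φ y p).2 = p.2 := rfl

theorem diagHom_injective : Function.Injective (diagHom φ) := by
  intro y z hyz
  ext δ
  exact congrArg Prod.fst (Equiv.congr_fun hyz (δ, 0))

/-- The element `(x, 1)(1 2)`. -/
def swapPerm (x : Equiv.Perm Δ) : Equiv.Perm (Δ × Fin 2) := topSwap Δ * basePerm ![x, 1]

@[simp] theorem swapPerm_apply_zero (x : Equiv.Perm Δ) (δ : Δ) :
    swapPerm x (δ, 0) = (x δ, 1) := rfl

@[simp] theorem swapPerm_apply_one (x : Equiv.Perm Δ) (δ : Δ) :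
    swapPerm x (δ, 1) = (δ, 0) := rfl

theorem swapPerm_apply_snd (x : Equiv.Perm Δ) (p : Δ × Fin 2) :
    (swapPerm x p).2 = Equiv.swap 0 1 p.2 := rfl

theorem swapPerm_mul_diagHom {x : H} (hφ : φ * φ = MulAut.conj x) (m : H) :
    swapPerm x.1 * diagHom φ m = diagHom φ (φ m) * swapPerm x.1 := by
  have h2 : φ (φ m) = x * m * x⁻¹ := DFunLike.congr_fun hφ m
  ext1 ⟨δ, i⟩
  revert i
  rw [Fin.forall_fin_two]
  simp [h2]

end Diagonal

theorem IsInternalDirectProduct.sup_eq {A : Type*} [Group A] {R S M : Subgroup A}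
    (h : IsInternalDirectProduct ![R, S] M) : R ⊔ S = M := by
  rw [← h.iSup_eq]
  apply le_antisymm
  · exact sup_le (le_iSup ![R, S] 0) (le_iSup ![R, S] 1)
  · refine iSup_le ?_
    rw [Fin.forall_fin_two]
    exact ⟨le_sup_left, le_sup_right⟩

namespace IsTypeB

variable {Δ : Type*} {G : Subgroup (Equiv.Perm (Δ × Fin 2))} {H : Subgroup (Equiv.Perm Δ)}
    {φ : MulAut H} {x : H} {R M : Subgroup H}

/-- φ² is inner and `R` is normal, so φ interchanges `R` and its image. -/
theorem imageUnder_imageUnder (hB : IsTypeB G H φ x R M) :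
    imageUnder φ (imageUnder φ R) = R := by
  have h2 : ∀ m, φ (φ m) = x * m * x⁻¹ := DFunLike.congr_fun hB.form.sq_eq
  have hR := hB.minimalNormal.normal
  apply le_antisymm
  · rintro _ ⟨_, ⟨r, hr, rfl⟩, rfl⟩
    change φ (φ r) ∈ R
    rw [h2]
    exact hR.conj_mem r hr x
  · intro r hr
    refine ⟨_, ⟨x⁻¹ * r * x, by simpa using hR.conj_mem r hr x⁻¹, rfl⟩, ?_⟩
    change φ (φ _) = r
    rw [h2]
    group

theorem imageUnder_product (hB : IsTypeB G H φ x R M) : imageUnder φ M = M := by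
  rw [← hB.product.sup_eq, imageUnder, Subgroup.map_sup, ← imageUnder, ← imageUnder,
    hB.imageUnder_imageUnder, sup_comm]

/-- The embedding `m ↦ (m, φ m)` of `M` in `G`. -/
def diagInclusion (hB : IsTypeB G H φ x R M) : M →* G :=
  ((diagHom φ).comp M.subtype).codRestrict G fun m => hB.diag_le ⟨m, m.2, rfl⟩

@[simp] theorem diagInclusion_coe (hB : IsTypeB G H φ x R M) (m : M) :
    (hB.diagInclusion m : Equiv.Perm (Δ × Fin 2)) = diagHom φ m := rfl

theorem diagInclusion_injective (hB : IsTypeB G H φ x R M) :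
    Function.Injective hB.diagInclusion := fun _ _ hmn =>
  Subtype.ext (diagHom_injective (congrArg Subtype.val hmn))

theorem diagInclusion_range (hB : IsTypeB G H φ x R M) :
    hB.diagInclusion.range = (diagSubgroup φ M).subgroupOf G := by
  ext g
  rw [Subgroup.mem_subgroupOf]
  constructor
  · rintro ⟨m, rfl⟩
    exact ⟨m, m.2, rfl⟩
  · rintro ⟨m, hm, hmg⟩
    exact ⟨⟨m, hm⟩, Subtype.ext hmg⟩

theorem exists_diagInclusion_smul_eq (hB : IsTypeB G H φ x R M) (u v : Δ × Fin 2)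
    (huv : u.2 = v.2) : ∃ m, hB.diagInclusion m • u = v := by
  obtain ⟨δ, i⟩ := u
  obtain ⟨δ', i'⟩ := v
  obtain rfl : i = i' := huv
  obtain ⟨m, hm⟩ := hB.product_transitive.exists_smul_eq δ δ'
  have hm' : m.1.1 δ = δ' := hm
  revert i
  rw [Fin.forall_fin_two]
  constructor
  · exact ⟨m, Prod.ext hm' rfl⟩
  -- On the second side the diagonal group acts through φ, and φ maps `M` onto itself.
  · obtain ⟨k, hk, hkm⟩ : m.1 ∈ imageUnder φ M := hB.imageUnder_product.symm ▸ m.2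
    have hkm' : φ k = m.1 := hkm
    refine ⟨⟨k, hk⟩, Prod.ext ?_ rfl⟩
    change (φ k).1 δ = δ'
    rw [hkm', hm']

/-- Every element of `G` is in `G⁺` or in its coset of `g = (x, 1)(1 2)`. -/
theorem exists_eq_diagHom (hB : IsTypeB G H φ x R M) {a : Equiv.Perm (Δ × Fin 2)} (ha : a ∈ G) :
    ∃ y, a = diagHom φ y ∨ a = swapPerm x.1 * diagHom φ y := by
  -- The sides are the orbits of a normal subgroup, hence blocks.
  have hside : ∀ b ∈ G, ∀ u v, u.2 = v.2 → (b u).2 = (b v).2 := by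
    intro b hb u v huv
    obtain ⟨m, rfl⟩ := hB.exists_diagInclusion_smul_eq u v huv
    have hn := hB.diag_minimalNormal.normal
    rw [← hB.diagInclusion_range] at hn
    obtain ⟨k, hk⟩ := hn.conj_mem _ ⟨m, rfl⟩ (⟨b, hb⟩ : G)
    have hk' : diagHom φ k * b = b * diagHom φ m := by
      have := congrArg Subtype.val hk
      simp only [diagInclusion_coe, Subgroup.coe_mul, Subgroup.coe_inv] at this
      rw [this, inv_mul_cancel_right]
    change (b u).2 = (b (diagHom φ m u)).2
    rw [← Equiv.Perm.mul_apply, ← hk', Equiv.Perm.mul_apply, diagHom_apply_snd]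
  have hpres : ∀ b ∈ G, (∀ p, (b p).2 = p.2) → ∃ y, b = diagHom φ y := by
    intro b hb hbp
    have : b ∈ G ⊓ sidePreserving Δ := ⟨hb, hbp⟩
    rw [hB.form.sidePreserving_eq] at this
    obtain ⟨y, -, rfl⟩ := this
    exact ⟨y, rfl⟩
  by_cases hp : ∀ p, (a p).2 = p.2
  · obtain ⟨y, hy⟩ := hpres a ha hp
    exact ⟨y, Or.inl hy⟩
  push Not at hp
  obtain ⟨p, hp⟩ := hp
  have hfin : ∀ x y z : Fin 2, x ≠ z → y ≠ z → x = y := by decide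
  have hall : ∀ q, (a q).2 ≠ q.2 := by
    intro q hq
    by_cases hqp : q.2 = p.2
    · exact hp (by rw [← hside a ha q p hqp, hq, hqp])
    · have h1 : (a p).2 = q.2 := hfin _ _ p.2 hp hqp
      obtain ⟨r, hr⟩ := a.surjective p
      have h2 : (a r).2 = q.2 := by
        by_cases hrp : r.2 = p.2
        · rw [hside a ha r p hrp, h1]
        · rw [hside a ha r q (hfin _ _ p.2 hrp hqp), hq]
      rw [hr] at h2
      exact hqp h2.symm
  have hg : swapPerm x.1 ∈ G := hB.form.swap_mem
  obtain ⟨y, hy⟩ := hpres ((swapPerm x.1)⁻¹ * a) (mul_mem (inv_mem hg) ha) (by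
    intro q
    have h1 := swapPerm_apply_snd x.1 (((swapPerm x.1)⁻¹ * a) q)
    rw [← Equiv.Perm.mul_apply, mul_inv_cancel_left] at h1
    have h2 := hall q
    rw [h1] at h2
    revert h2
    generalize (((swapPerm x.1)⁻¹ * a) q).2 = t
    generalize q.2 = t'
    revert t t'
    decide)
  exact ⟨y, Or.inr (by rw [← hy, mul_inv_cancel_left])⟩

end IsTypeB

/-- Half 0 consists of the factors of `R` and half 1 of those of its image under φ. Irreducibility
comes from the minimality of the diagonal subgroup, faithfulness of conjugation from its being the
socle. -/
theorem IsTypeBi.exists_isHalvedAction {Δ : Type*} [Finite Δ] [Nonempty Δ]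
    {G : Subgroup (Equiv.Perm (Δ × Fin 2))} {H : Subgroup (Equiv.Perm Δ)} {φ : MulAut H} {x : H}
    {R M : Subgroup H} (hB : IsTypeBi G H φ x R M) {d : ℕ} {Γ : SimpleGraph (Δ × Fin 2)}
    (hA : MemFamilyA d Γ G) {T : Type*} [Group T] [IsSimpleGroup T]
    (hT : ∃ a b : T, a * b ≠ b * a) {l : ℕ} (Ψ : M ≃* (Fin 2 × Fin l → T))
    (h0 : ∀ m, (∀ j, Ψ m (0, j) = 1) ↔ (m : H) ∈ imageUnder φ R)
    (h1 : ∀ m, (∀ j, Ψ m (1, j) = 1) ↔ (m : H) ∈ R) :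
    ∃ c, IsHalvedAction d Γ (hB.diagInclusion.comp Ψ.symm.toMonoidHom) c Prod.snd := by
  set ψ := hB.diagInclusion.comp Ψ.symm.toMonoidHom
  have hψa : ∀ y, ψ y = hB.diagInclusion (Ψ.symm y) := fun _ => rfl
  have hψ : Function.Injective ψ := hB.diagInclusion_injective.comp Ψ.symm.injective
  have hrange : ψ.range = (diagSubgroup φ M).subgroupOf G := by
    rw [← hB.diagInclusion_range]
    apply le_antisymm
    · rintro _ ⟨y, rfl⟩
      exact ⟨_, rfl⟩
    · rintro _ ⟨m, rfl⟩
      exact ⟨Ψ m, by rw [hψa, MulEquiv.symm_apply_apply]⟩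
  obtain ⟨c, hc⟩ := exists_conj_hom hψ (hrange ▸ hB.diag_minimalNormal.normal)
  have hGt := hA.transitive
  have hRn := hB.minimalNormal.normal
  have hSn : (imageUnder φ R).Normal := hRn.map _ φ.surjective
  have hconj : ∀ (a : G) (z : H →* H),
      (∀ m, (a : Equiv.Perm (Δ × Fin 2)) * diagHom φ m = diagHom φ (z m) * a) →
      ∀ y, ((Ψ.symm (c a y) : M) : H) = z (Ψ.symm y : M) := by
    intro a z hz y
    apply diagHom_injective (φ := φ)
    have h2 := congrArg Subtype.val (hc a y)
    rw [hψa, hψa] at h2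
    simp only [IsTypeB.diagInclusion_coe, Subgroup.coe_mul, Subgroup.coe_inv] at h2
    rw [h2, hz, mul_inv_cancel_right]
  have h0' : ∀ y, (∀ j, y (0, j) = 1) ↔ ((Ψ.symm y : M) : H) ∈ imageUnder φ R := fun y => by
    rw [← h0, MulEquiv.apply_symm_apply]
  have h1' : ∀ y, (∀ j, y (1, j) = 1) ↔ ((Ψ.symm y : M) : H) ∈ R := fun y => by
    rw [← h1, MulEquiv.apply_symm_apply]
  -- The swap condition is closed under products, so it suffices to check it on diagonal elements,
  -- which normalise `R` and its image, and on g, which acts on `M` as φ and interchanges them.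
  let P : G → Prop := fun a => ∃ s : Equiv.Perm (Fin 2),
    (∀ v : Δ × Fin 2, (a • v).2 = s v.2) ∧ ∀ t y, (∀ j, y (t, j) = 1) → ∀ j, c a y (s t, j) = 1
  have hPmul : ∀ a b, P a → P b → P (a * b) := by
    rintro a b ⟨s, hs1, hs2⟩ ⟨s', hs1', hs2'⟩
    refine ⟨s * s', fun v => ?_, fun t y hy => ?_⟩
    · rw [mul_smul, hs1, hs1', Equiv.Perm.mul_apply]
    · have := hs2 _ _ (hs2' t y hy)
      rwa [map_mul]
  have hPdiag : ∀ (a : G) y, (a : Equiv.Perm (Δ × Fin 2)) = diagHom φ y → P a := by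
    intro a y hy
    refine ⟨1, fun v => ?_, fun t z hz => ?_⟩
    · change ((a : Equiv.Perm (Δ × Fin 2)) v).2 = v.2
      rw [hy, diagHom_apply_snd]
    · have h2 := hconj a (MulAut.conj y).toMonoidHom (fun m => by
        rw [hy, ← map_mul, ← map_mul]
        congr 1
        simp) z
      revert t
      rw [Fin.forall_fin_two]
      simp only [Equiv.Perm.one_apply]
      constructor
      · rw [h0', h0', h2]
        exact fun hm => hSn.conj_mem _ hm y
      · rw [h1', h1', h2]
        exact fun hm => hRn.conj_mem _ hm y
  have hg : swapPerm x.1 ∈ G := hB.form.swap_mem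
  have hPswap : P ⟨swapPerm x.1, hg⟩ := by
    refine ⟨Equiv.swap 0 1, fun v => rfl, fun t z hz => ?_⟩
    have h2 := hconj ⟨swapPerm x.1, hg⟩ φ.toMonoidHom (swapPerm_mul_diagHom hB.form.sq_eq) z
    revert t
    rw [Fin.forall_fin_two, Equiv.swap_apply_left, Equiv.swap_apply_right]
    constructor
    · rw [h0', h1', h2]
      intro hm
      rw [← hB.imageUnder_imageUnder]
      exact ⟨_, hm, rfl⟩
    · rw [h0', h1', h2]
      exact fun hm => ⟨_, hm, rfl⟩
  refine ⟨c,
    { noncomm := hT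
      connected := hA.connected
      adj_smul := fun a u v huv => (hA.preserves a a.2 u v).2 huv
      valency_le := hA.valency_le
      transitive := hGt.exists_smul_eq
      injective := hψ
      conj_injective :=
        conj_hom_injective_of_socle_eq hT hψ (hB.socle_eq.trans hrange.symm) hc
      map_conj := hc
      side_surjective := fun t => ⟨(Classical.arbitrary Δ, t), rfl⟩
      side_smul := fun y v => rfl
      exists_smul_eq := fun u v huv => ?_
      swap := fun a => ?_
      irreducible := fun X hX => ?_ }⟩
  · obtain ⟨m, hm⟩ := hB.exists_diagInclusion_smul_eq u v huv
    exact ⟨Ψ m, by rw [hψa, MulEquiv.symm_apply_apply, hm]⟩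
  · obtain ⟨y, hy | hy⟩ := hB.exists_eq_diagHom a.2
    · exact hPdiag a y hy
    · have h2 : P (⟨swapPerm x.1, hg⟩⁻¹ * a) → P a := fun hh => by
        simpa using hPmul _ _ hPswap hh
      exact h2 (hPdiag _ y (by simp [hy]))
  · have hXn : (X.map ψ).Normal := by
      refine ⟨?_⟩
      rintro _ ⟨y, hy, rfl⟩ a
      exact ⟨c a y, hX a y hy, hc a y⟩
    rcases hB.diag_minimalNormal.minimal (X.map ψ) hXn (by
      rw [← hrange]; exact Subgroup.map_le_range ψ X) with hb | ht
    · left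
      rwa [Subgroup.map_eq_bot_iff_of_injective X hψ] at hb
    · right
      rw [← hrange, MonoidHom.range_eq_map] at ht
      exact Subgroup.map_injective hψ ht

/-- Membership in the family `𝒜(d)` is preserved by an identification of the vertex set. -/
theorem MemFamilyA.carryGroup {V Δ : Type*} {d : ℕ} {Γ : SimpleGraph V}
    {G : Subgroup (Equiv.Perm V)} (hA : MemFamilyA d Γ G) (e : V ≃ Δ × Fin 2) :
    MemFamilyA d (Γ.comap e.symm) (carryGroup e G) where
  pos := hA.pos
  connected := (SimpleGraph.Iso.connected_iff (SimpleGraph.Iso.comap e.symm Γ)).2 hA.connected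
  preserves := by
    rintro _ ⟨g, hg, rfl⟩ u v
    simpa using hA.preserves g hg (e.symm u) (e.symm v)
  transitive := ⟨fun u v => by
    obtain ⟨g, hg⟩ := hA.transitive.exists_smul_eq (e.symm u) (e.symm v)
    have hg' : g.1 (e.symm u) = e.symm v := hg
    refine ⟨⟨_, ⟨g.1, g.2, rfl⟩⟩, ?_⟩
    change e (g.1 (e.symm u)) = v
    rw [hg', Equiv.apply_symm_apply]⟩
  valency_le v := by
    have : (Γ.comap e.symm).neighborSet v = e '' Γ.neighborSet (e.symm v) := by
      ext u
      simp [SimpleGraph.mem_neighborSet, Equiv.image_eq_preimage_symm]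
    rw [this, Set.ncard_image_of_injective _ e.injective]
    exact hA.valency_le _

theorem mainTheorem11 {V Δ : Type*} [Finite V] (d : ℕ) (Γ : SimpleGraph V)
    (G : Subgroup (Equiv.Perm V)) (hA : MemFamilyA d Γ G)
    (e : V ≃ Δ × Fin 2) (H : Subgroup (Equiv.Perm Δ)) (φ : MulAut H) (x : H)
    (R M : Subgroup H) (hB : IsTypeBi (carryGroup e G) H φ x R M)
    {T : Type*} [Group T] (hTsimple : IsSimpleGroup T) (hTnonabelian : ∃ a b : T, a * b ≠ b * a)
    (l : ℕ) (TR TS : Fin l → Subgroup H)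
    (hTR : ∀ j, Nonempty (TR j ≃* T)) (hTS : ∀ j, Nonempty (TS j ≃* T))
    (hR : IsInternalDirectProduct TR R) (hS : IsInternalDirectProduct TS (imageUnder φ R))
    (hsurj : ∃ (j : Fin l) (α : Δ), Function.Surjective (projLeft hB.product hR j α) ∨
      Function.Surjective (projRight hB.product hS j α)) :
    IsFBounded (fun n => (n ^ 2 * (n * (n - 1)).factorial ^ 2).factorial) d G := by
  obtain ⟨j, α, hsurj⟩ := hsurj
  have : Nonempty Δ := ⟨α⟩
  have : Finite (Δ × Fin 2) := Finite.of_equiv V e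
  have : Finite Δ := Finite.of_injective (fun δ : Δ => (δ, (0 : Fin 2))) fun _ _ h =>
    congrArg Prod.fst h
  have τR : ∀ j, TR j ≃* T := fun j => (hTR j).some
  have τS : ∀ j, TS j ≃* T := fun j => (hTS j).some
  have : Finite T := Finite.of_equiv _ (τR j).toEquiv
  obtain ⟨Ψ, hΨ0, hΨ1⟩ := hB.product.exists_mulEquiv_pi hR hS τR τS
  have h0 : ∀ m, (∀ j, Ψ m (0, j) = 1) ↔ (m : H) ∈ imageUnder φ R := by
    intro m
    rw [show imageUnder φ R = (![R, imageUnder φ R] : Fin 2 → Subgroup H) 1 from rfl,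
      hB.product.mem_iff_forall_proj_eq_one 1 m, Fin.forall_fin_two]
    simp only [hΨ0, EmbeddingLike.map_eq_one_iff]
    constructor
    · exact fun hh => ⟨fun _ => hR.eq_one_of_proj_eq_one hh, fun hn => absurd rfl hn⟩
    · intro hh j
      rw [hh.1 (by decide)]
      exact map_one (hR.proj j)
  have h1 : ∀ m, (∀ j, Ψ m (1, j) = 1) ↔ (m : H) ∈ R := by
    intro m
    rw [show (m : H) ∈ R ↔ (m : H) ∈ (![R, imageUnder φ R] : Fin 2 → Subgroup H) 0 from Iff.rfl,
      hB.product.mem_iff_forall_proj_eq_one 0 m, Fin.forall_fin_two]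
    simp only [hΨ1, EmbeddingLike.map_eq_one_iff]
    constructor
    · exact fun hh => ⟨fun hn => absurd rfl hn, fun _ => hS.eq_one_of_proj_eq_one hh⟩
    · intro hh j
      rw [hh.2 (by decide)]
      exact map_one (hS.proj j)
  obtain ⟨c, hc⟩ := hB.exists_isHalvedAction (hA.carryGroup e) hTnonabelian Ψ h0 h1
  have hfix : ∀ m : MulAction.stabilizer M α,
      hB.diagInclusion (Ψ.symm (Ψ m.1)) • ((α, 0) : Δ × Fin 2) = (α, 0) := fun m => by
    rw [MulEquiv.symm_apply_apply]
    exact Prod.ext m.2 rfl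
  have hcard : Nat.card (carryGroup e G) ≤ (d ^ 2 * (d * (d - 1)).factorial ^ 2).factorial := by
    rcases hsurj with hs | hs
    · refine hc.card_le (v₀ := (α, 0)) (i₀ := (0, j)) rfl fun t => ?_
      obtain ⟨m, hm⟩ := hs ((τR j).symm t)
      refine ⟨Ψ m.1, hfix m, ?_⟩
      rw [hΨ0]
      exact (congrArg (τR j) hm).trans ((τR j).apply_symm_apply t)
    -- With the sides relabelled, (α, 0) lies on side 1 and so is matched with the factors of S.
    · refine (hc.comp_perm (Equiv.swap 0 1)).card_le (v₀ := (α, 0)) (i₀ := (1, j)) rfl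
        fun t => ?_
      obtain ⟨m, hm⟩ := hs ((τS j).symm t)
      refine ⟨Ψ m.1, hfix m, ?_⟩
      rw [hΨ1]
      exact (congrArg (τS j) hm).trans ((τS j).apply_symm_apply t)
  have hG : Nat.card (carryGroup e G) = Nat.card G :=
    (Nat.card_congr (G.equivMapOfInjective _ e.permCongrHom.injective).toEquiv).symm
  intro v
  rw [hG] at hcard
  exact (Subgroup.card_le_card_group _).trans hcard
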